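/- Let $A$ be a finite totally ordered alphabet. A word is a finite sequence of letters; words are ordered first by length and then lexicographically. A p-sentence is a finite weakly decreasing sequence $P=(w_1,\dots,w_k)$ of non-empty words; its size is $|P|=\sum_i|w_i|$. Write $Q\sqsubseteq P$ if the multiset of words of $Q$ is contained in that of $P$, and let $P\setminus Q$ be the p-sentence formed by the remaining words of $P$. $PSym_A=\mathbb{Q}[h_w: w\text{ a non-empty word}]$ is the commutative polynomial algebra with basis $h_P=h_{w_1}\cdots h_{w_k}$, graded by $|P|$. It is a Hopf algebra, with coproduct and counit the algebra morphisms given by $\Delta(h_w)=\sum_{w=uv}h_u\otimes h_v$ (where $h_\emptyset=1$) and $\varepsilon(h_w)=0$. $Sym_A$ is the algebra of formal power series over $\mathbb{Q}$ of bounded degree in variables $x_{a,i}$ ($a\in A$, $i\ge 1$), where $x_{a,i}$ and $x_{b,j}$ commute if $i\ne j$ and satisfy no other relations, that are invariant under all permutations of the second indices. It has the basis $m_P$, where $m_P$ is the sum of all monomials $x_{v_1,j_1}\cdots x_{v_k,j_k}$ ($j_1<\dots<j_k$, $v_i$ non-empty words, $x_{v,j}$ denoting the product of the variables of second index $j$ spelling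 $v$) such that $(v_1,\dots,v_k)$ sorts to $P$. It is a Hopf algebra with $\Delta(m_P)=\sum_{Q\sqsubseteq P}m_Q\otimes m_{P\setminus Q}$, $\varepsilon(m_\emptyset)=1$ and $\varepsilon(m_P)=0$ for $P\neq\emptyset$. **Theorem.** There is a unique bilinear form $\langle\cdot,\cdot\rangle:PSym_A\times Sym_A\to\mathbb{Q}$ with $\langle h_P,m_Q\rangle=\delta_{P,Q}$ for all p-sentences $P,Q$, and $PSym_A$ and $Sym_A$ are dually paired by it: for all $b,b_1,b_2\in PSym_A$ and $a,a_1,a_2\in Sym_A$, $$\langle b_1b_2,a\rangle=\langle b_1\otimes b_2,\Delta(a)\rangle,\quad \langle 1,a\rangle=\varepsilon(a),\quad \langle b,a_1a_2\rangle=\langle\Delta(b),a_1\otimes a_2\rangle,\quad \varepsilon(b)=\langle b,1\rangle,\quad \langle S(b),a\rangle=\langle b,S(a)\rangle,$$ where $S$ denotes the antipodes and $\langle b_1\otimes b_2,a_1\otimes a_2\rangle=\langle b_1,a_1\rangle\langle b_2,a_2\rangle$. Moreover, let $PSym_A^*$ be the graded dual of $PSym_A$ (the linear forms vanishing on all but finitely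 many homogeneous components), with product $(\varphi\psi)(x)=(\varphi\otimes\psi)(\Delta x)$ and unit $\varepsilon$, and with coproduct $\Delta(h^*_P)=\sum_{Q\sqsubseteq P}h^*_Q\otimes h^*_{P\setminus Q}$ and counit $\varphi\mapsto\varphi(1)$, where $(h^*_P)$ is the basis dual to $(h_P)$. Then $PSym_A^*$ is a Hopf algebra that is dually paired with $PSym_A$ by evaluation, and there is an isomorphism of Hopf algebras $PSym_A^*\to Sym_A$ with $h^*_P\mapsto m_P$ for every p-sentence $P$. -/

import Mathlib

set_option linter.unusedSectionVars false

open scoped TensorProduct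

section Convolution
variable {ι H : Type*} [Ring H] [Bialgebra ℚ H]

/-- The span of the tensors `b i ⊗ b j` with `deg i + deg j = n`. -/
def tensorDegree (b : ι → H) (deg : ι → ℕ) (n : ℕ) : Submodule ℚ (H ⊗[ℚ] H) :=
  Submodule.span ℚ {t | ∃ i j, deg i + deg j = n ∧ t = b i ⊗ₜ[ℚ] b j}

theorem exists_convInverse (b : Module.Basis ι ℚ H) (deg : ι → ℕ)
    (hΔ : ∀ i, Coalgebra.comul (R := ℚ) (b i) ∈ tensorDegree b deg (deg i))
    (h0 : ∀ i, deg i = 0 → b i = 1) :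
    ∃ S : H →ₗ[ℚ] H,
      LinearMap.mul' ℚ H ∘ₗ S.rTensor H ∘ₗ Coalgebra.comul
        = Algebra.linearMap ℚ H ∘ₗ Coalgebra.counit ∧
      LinearMap.mul' ℚ H ∘ₗ S.lTensor H ∘ₗ Coalgebra.comul
        = Algebra.linearMap ℚ H ∘ₗ Coalgebra.counit := by
  classical
  let J : WithConv (H →ₗ[ℚ] H) := 1 - WithConv.toConv LinearMap.id
  have key : ∀ n i, deg i < n → (J ^ n) (b i) = 0 := by
    intro n
    induction n with
    | zero => intro i hi; omega
    | succ n ih =>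
      intro i hi
      rw [pow_succ', LinearMap.convMul_apply]
      have : ∀ t ∈ tensorDegree b deg (deg i),
          LinearMap.mul' ℚ H (TensorProduct.map J.ofConv (J ^ n).ofConv t) = 0 := by
        intro t ht
        induction ht using Submodule.span_induction with
        | mem t ht =>
          obtain ⟨j, k, hjk, rfl⟩ := ht
          rw [TensorProduct.map_tmul, LinearMap.mul'_apply]
          rcases Nat.eq_zero_or_pos (deg j) with h | h
          · have : J.ofConv (b j) = 0 := by
              rw [h0 j h]
              change ((1 : WithConv (H →ₗ[ℚ] H)) 1 : H) - 1 = 0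
              simp
            rw [this, zero_mul]
          · have : (J ^ n).ofConv (b k) = 0 := ih k (by omega)
            rw [this, mul_zero]
        | zero => simp
        | add x y _ _ hx hy => rw [map_add, map_add, hx, hy, add_zero]
        | smul c x _ hx => rw [map_smul, map_smul, hx, smul_zero]
      exact this _ (hΔ i)
  -- partial sums of the geometric series
  let T : ℕ → WithConv (H →ₗ[ℚ] H) := fun n => ∑ k ∈ Finset.range n, J ^ k
  have Tstep : ∀ i n, deg i < n → T n (b i) = T (deg i + 1) (b i) := by
    intro i n hn
    induction n, hn using Nat.le_induction with
    | base => rfl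
    | succ m hm ih =>
      have : T (m + 1) = T m + J ^ m := Finset.sum_range_succ _ _
      rw [this, ← ih]
      change T m (b i) + (J ^ m) (b i) = _
      rw [key m i (by omega), add_zero]
  let S : H →ₗ[ℚ] H := b.constr ℚ fun i => T (deg i + 1) (b i)
  have hS : ∀ i n, deg i < n → S (b i) = (T n).ofConv (b i) := by
    intro i n hn
    rw [Module.Basis.constr_basis]
    exact (Tstep i n hn).symm
  have agree : ∀ n, ∀ m < n, ∀ t ∈ tensorDegree b deg m,
      S.rTensor H t = (T n).ofConv.rTensor H t ∧ S.lTensor H t = (T n).ofConv.lTensor H t := by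
    intro n m hm t ht
    induction ht using Submodule.span_induction with
    | mem t ht =>
      obtain ⟨j, k, hjk, rfl⟩ := ht
      simp only [LinearMap.rTensor_tmul, LinearMap.lTensor_tmul]
      rw [hS j n (by omega), hS k n (by omega)]
      exact ⟨rfl, rfl⟩
    | zero => simp
    | add x y _ _ hx hy => simp only [map_add, hx.1, hx.2, hy.1, hy.2, and_self]
    | smul c x _ hx => simp only [map_smul, hx.1, hx.2, and_self]
  have e1 : ∀ n, T n * WithConv.toConv LinearMap.id = 1 - J ^ n := by
    intro n
    have : (WithConv.toConv LinearMap.id : WithConv (H →ₗ[ℚ] H)) = 1 - J := by simp [J]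
    rw [this]
    exact geom_sum_mul_neg J n
  have e2 : ∀ n, WithConv.toConv LinearMap.id * T n = 1 - J ^ n := by
    intro n
    have : (WithConv.toConv LinearMap.id : WithConv (H →ₗ[ℚ] H)) = 1 - J := by simp [J]
    rw [this]
    exact mul_neg_geom_sum J n
  refine ⟨S, b.ext fun i => ?_, b.ext fun i => ?_⟩
  · have h := congrArg (fun f : WithConv (H →ₗ[ℚ] H) => f (b i)) (e1 (deg i + 1))
    have h' : (1 - J ^ (deg i + 1)) (b i) = (1 : WithConv (H →ₗ[ℚ] H)) (b i) := by
      change (1 : WithConv (H →ₗ[ℚ] H)) (b i) - (J ^ (deg i + 1)) (b i) = _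
      rw [key _ i (by omega), sub_zero]
    simp only [LinearMap.comp_apply]
    rw [(agree (deg i + 1) _ (by omega) _ (hΔ i)).1]
    exact h.trans h'
  · have h := congrArg (fun f : WithConv (H →ₗ[ℚ] H) => f (b i)) (e2 (deg i + 1))
    have h' : (1 - J ^ (deg i + 1)) (b i) = (1 : WithConv (H →ₗ[ℚ] H)) (b i) := by
      change (1 : WithConv (H →ₗ[ℚ] H)) (b i) - (J ^ (deg i + 1)) (b i) = _
      rw [key _ i (by omega), sub_zero]
    simp only [LinearMap.comp_apply]
    rw [(agree (deg i + 1) _ (by omega) _ (hΔ i)).2]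
    exact h.trans h'
end Convolution

/-- Non-empty words in the alphabet `A`. -/
@[ext]
structure Word (A : Type*) where
  /-- The letters. -/
  val : List A
  ne_nil : val ≠ []

namespace Word
variable {A : Type*}

/-- The size `|w|`: the number of letters. -/
def size (w : Word A) : ℕ := w.1.length

theorem size_pos (w : Word A) : 0 < w.size := List.length_pos_of_ne_nil w.2

/-- The graded lexicographic order: first by size, then lexicographically. -/
noncomputable instance [LinearOrder A] : LinearOrder (Word A) :=
  LinearOrder.lift' (fun w : Word A => toLex (w.1.length, w.1)) fun _ _ h =>
    Word.ext (congrArg Prod.snd (toLex.injective h))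

open Classical in
/-- The non-empty word `w`, or nothing if `w` is empty. -/
noncomputable def toWord (w : List A) : Option (Word A) := if h : w ≠ [] then some ⟨w, h⟩ else none

end Word

/-- A p-sentence: a finite sequence of non-empty words that is weakly decreasing in the graded
lexicographic order. -/
@[ext]
structure PSent (A : Type*) [LinearOrder A] where
  /-- The words. -/
  val : List (Word A)
  sorted : val.Pairwise (· ≥ ·)

namespace PSent
variable {A : Type*} [LinearOrder A]

noncomputable instance : DecidableEq (PSent A) := Classical.decEq _

/-- The p-sentence obtained by sorting a (multiset underlying a) sentence. -/
noncomputable def sort (s : Multiset (Word A)) : PSent A :=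
  ⟨s.sort (· ≥ ·), s.pairwise_sort (· ≥ ·)⟩

/-- The multiset of words of a p-sentence. -/
def toMultiset (P : PSent A) : Multiset (Word A) := (P.1 : Multiset (Word A))

@[simp] theorem toMultiset_sort (s : Multiset (Word A)) : (sort s).toMultiset = s :=
  s.sort_eq _

@[simp] theorem sort_toMultiset (P : PSent A) : sort P.toMultiset = P :=
  PSent.ext (List.Perm.eq_of_pairwise' (r := (· ≥ ·)) (sort P.toMultiset).2 P.2
    (Multiset.coe_eq_coe.mp (toMultiset_sort _)))

/-- P-sentences are the same as finite multisets of non-empty words. -/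
noncomputable def equivMultiset : PSent A ≃ Multiset (Word A) :=
  ⟨toMultiset, sort, sort_toMultiset, toMultiset_sort⟩

/-- The size `|P|`: the total number of colors. -/
def size (P : PSent A) : ℕ := (P.toMultiset.map Word.size).sum

/-- The empty p-sentence. -/
noncomputable def empty : PSent A := sort 0

/-- The p-sentences `Q` whose words form a submultiset of the words of `P`. -/
noncomputable def sub (P : PSent A) : Finset (PSent A) :=
  (Finset.Iic P.toMultiset).map equivMultiset.symm.toEmbedding

/-- The p-sentence obtained from `P` by removing the words of `Q`. -/
noncomputable def diff (P Q : PSent A) : PSent A := sort (P.toMultiset - Q.toMultiset)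

end PSent

/-- `PSym_A`: the commutative polynomial algebra over `ℚ` on generators `h_w`, one for each
non-empty word `w`. -/
def PSym (A : Type*) : Type _ := MvPolynomial (Word A) ℚ

namespace PSym
variable {A : Type*}

noncomputable instance : CommRing (PSym A) := inferInstanceAs (CommRing (MvPolynomial (Word A) ℚ))
noncomputable instance : Algebra ℚ (PSym A) :=
  inferInstanceAs (Algebra ℚ (MvPolynomial (Word A) ℚ))

/-- The identification with the polynomial algebra. -/
noncomputable def toMv : PSym A ≃ₐ[ℚ] MvPolynomial (Word A) ℚ :=
  (AlgEquiv.refl : MvPolynomial (Word A) ℚ ≃ₐ[ℚ] MvPolynomial (Word A) ℚ)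

open Classical in
/-- The generator `h_w`, with the convention `h_∅ = 1`. -/
noncomputable def gen (w : List A) : PSym A :=
  if hw : w ≠ [] then toMv.symm (MvPolynomial.X ⟨w, hw⟩) else 1

theorem gen_nil : gen ([] : List A) = 1 := by simp [gen]

theorem gen_word (w : Word A) : gen w.1 = toMv.symm (MvPolynomial.X w) := by
  exact dif_pos w.2

/-- The algebra morphism with prescribed values on the generators. -/
noncomputable def lift {R : Type*} [CommRing R] [Algebra ℚ R] (f : Word A → R) : PSym A →ₐ[ℚ] R :=
  (MvPolynomial.aeval f).comp toMv.toAlgHom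

theorem lift_gen {R : Type*} [CommRing R] [Algebra ℚ R] (f : Word A → R) (w : Word A) :
    lift f (gen w.1) = f w := by
  rw [gen_word]; simp [lift]

theorem algHom_ext {R : Type*} [CommRing R] [Algebra ℚ R] {f g : PSym A →ₐ[ℚ] R}
    (h : ∀ w : Word A, f (gen w.1) = g (gen w.1)) : f = g := by
  have : f.comp toMv.symm.toAlgHom = g.comp toMv.symm.toAlgHom :=
    MvPolynomial.algHom_ext fun w => by simpa [gen_word] using h w
  ext x
  simpa using congrArg (fun φ => φ (toMv x)) this

/-- `Δ(h_w) = ∑_{w = uv} h_u ⊗ h_v`, extended to a morphism of algebras. -/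
noncomputable def comulHom : PSym A →ₐ[ℚ] PSym A ⊗[ℚ] PSym A :=
  lift fun w => ∑ i ∈ Finset.range (w.1.length + 1), gen (w.1.take i) ⊗ₜ[ℚ] gen (w.1.drop i)

/-- `ε(h_w) = 0` for every non-empty word, extended to a morphism of algebras. -/
noncomputable def counitHom : PSym A →ₐ[ℚ] ℚ := lift fun _ => 0

theorem comulHom_gen (w : List A) : comulHom (gen w) =
    ∑ i ∈ Finset.range (w.length + 1), gen (w.take i) ⊗ₜ[ℚ] gen (w.drop i) := by
  by_cases h : w = []
  · subst h; simp [gen_nil, Algebra.TensorProduct.one_def]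
  · exact lift_gen _ ⟨w, h⟩

theorem counitHom_gen (w : List A) : counitHom (gen w) = if w = [] then 1 else 0 := by
  by_cases h : w = []
  · subst h; simp [gen_nil]
  · rw [if_neg h]; exact lift_gen _ ⟨w, h⟩

noncomputable instance : Bialgebra ℚ (PSym A) :=
  Bialgebra.ofAlgHom comulHom counitHom
    (by
      refine algHom_ext fun w => ?_
      simp only [AlgHom.comp_apply, comulHom_gen, map_sum, Algebra.TensorProduct.map_tmul,
        AlgHom.id_apply, TensorProduct.sum_tmul, TensorProduct.tmul_sum]
      rw [Finset.sum_sigma', Finset.sum_sigma']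
      refine Finset.sum_bij' (fun p _ => ⟨p.2, p.1 - p.2⟩) (fun p _ => ⟨p.1 + p.2, p.1⟩)
        ?_ ?_ ?_ ?_ ?_
      · rintro ⟨i, j⟩ h; simp at h ⊢; omega
      · rintro ⟨i, j⟩ h; simp at h ⊢; omega
      · rintro ⟨i, j⟩ h; simp at h ⊢; omega
      · rintro ⟨i, j⟩ h; simp at h ⊢
      · rintro ⟨i, j⟩ h
        simp at h
        have hj : j ≤ i := by omega
        have : i = j + (i - j) := by omega
        change (TensorProduct.assoc ℚ _ _ _) _ = _
        rw [TensorProduct.assoc_tmul, List.take_take, List.drop_take, List.drop_drop,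
          min_eq_left hj, ← this])
    (by
      refine algHom_ext fun w => ?_
      simp only [AlgHom.comp_apply, comulHom_gen, map_sum, Algebra.TensorProduct.map_tmul,
        AlgHom.id_apply, counitHom_gen]
      rw [Finset.sum_eq_single 0]
      · simp
      · intro i hi h0
        have : w.1.take i ≠ [] := by simp [h0, w.2]
        rw [if_neg this, TensorProduct.zero_tmul]
      · simp)
    (by
      refine algHom_ext fun w => ?_
      simp only [AlgHom.comp_apply, comulHom_gen, map_sum, Algebra.TensorProduct.map_tmul,
        AlgHom.id_apply, counitHom_gen]
      rw [Finset.sum_eq_single w.1.length]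
      · simp
      · intro i hi h0
        have : w.1.drop i ≠ [] := by simp at hi ⊢; omega
        rw [if_neg this, TensorProduct.tmul_zero]
      · simp)

theorem comul_gen (w : List A) : Coalgebra.comul (R := ℚ) (gen w) =
    ∑ i ∈ Finset.range (w.length + 1), gen (w.take i) ⊗ₜ[ℚ] gen (w.drop i) := comulHom_gen w

theorem counit_gen (w : List A) :
    Coalgebra.counit (R := ℚ) (gen w) = if w = [] then 1 else 0 := counitHom_gen w

/-- `h_s = ∏_{w ∈ s} h_w`. -/
noncomputable def hM (s : Multiset (Word A)) : PSym A := (s.map fun w => gen w.1).prod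

theorem hM_zero : hM (0 : Multiset (Word A)) = 1 := by simp [hM]
theorem hM_add (s t : Multiset (Word A)) : hM (s + t) = hM s * hM t := by simp [hM]
theorem hM_cons (w : Word A) (t : Multiset (Word A)) : hM (w ::ₘ t) = gen w.1 * hM t := by simp [hM]

open Classical in
theorem exists_basis_hM : ∃ b : Module.Basis (Multiset (Word A)) ℚ (PSym A), ∀ s, b s = hM s := by
  refine ⟨((MvPolynomial.basisMonomials (Word A) ℚ).reindex
    Multiset.toFinsupp.symm.toEquiv).map toMv.symm.toLinearEquiv, fun s => ?_⟩
  rw [Module.Basis.map_apply, Module.Basis.reindex_apply, MvPolynomial.coe_basisMonomials]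
  change toMv.symm (MvPolynomial.monomial (Multiset.toFinsupp s) (1 : ℚ)) = _
  induction s using Multiset.induction with
  | empty => rw [hM_zero, map_zero]; exact map_one toMv.symm
  | cons w t ih =>
    rw [hM_cons, ← ih, gen_word, ← Multiset.singleton_add, map_add, Multiset.toFinsupp_singleton,
      MvPolynomial.X, ← map_mul, MvPolynomial.monomial_mul, one_mul]

/-- The total number of letters of a multiset of words. -/
def mSize (s : Multiset (Word A)) : ℕ := (s.map Word.size).sum

theorem mSize_add (s t : Multiset (Word A)) : mSize (s + t) = mSize s + mSize t := by simp [mSize]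

theorem mSize_singleton (w : Word A) : mSize {w} = w.1.length := by simp [mSize, Word.size]

theorem hM_singleton (w : Word A) : hM {w} = gen w.1 := by simp [hM]

theorem mSize_eq_zero {s : Multiset (Word A)} (h : mSize s = 0) : s = 0 := by
  induction s using Multiset.induction with
  | empty => rfl
  | cons w t ih =>
    have := w.size_pos
    simp [mSize] at h; omega

theorem tensorDegree_mul {m n : ℕ} {x y : PSym A ⊗[ℚ] PSym A} (hx : x ∈ tensorDegree hM mSize m)
    (hy : y ∈ tensorDegree hM mSize n) : x * y ∈ tensorDegree hM mSize (m + n) := by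
  have : tensorDegree hM mSize m * tensorDegree hM mSize n ≤
      (tensorDegree (hM (A := A)) mSize (m + n)) := by
    rw [tensorDegree, tensorDegree, Submodule.span_mul_span, Submodule.span_le]
    rintro _ ⟨_, ⟨i, j, hij, rfl⟩, _, ⟨k, l, hkl, rfl⟩, rfl⟩
    refine Submodule.subset_span ⟨i + k, j + l, ?_, ?_⟩
    · rw [mSize_add, mSize_add]; omega
    · simp only [Algebra.TensorProduct.tmul_mul_tmul, hM_add]
  exact this (Submodule.mul_mem_mul hx hy)

theorem exists_gen_eq (w : List A) : ∃ s : Multiset (Word A), mSize s = w.length ∧ gen w = hM s := by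
  by_cases h : w = []
  · subst h; exact ⟨0, by simp [mSize], by rw [gen_nil, hM_zero]⟩
  · let v : Word A := ⟨w, h⟩
    exact ⟨{v}, mSize_singleton v, (hM_singleton v).symm⟩

theorem comul_hM_mem (s : Multiset (Word A)) :
    Coalgebra.comul (R := ℚ) (hM s) ∈ tensorDegree hM mSize (mSize s) := by
  induction s using Multiset.induction with
  | empty =>
    rw [hM_zero, Bialgebra.comul_one]
    exact Submodule.subset_span ⟨0, 0, by simp [mSize], by rw [hM_zero]; rfl⟩
  | cons w t ih =>
    rw [hM_cons, Bialgebra.comul_mul, ← Multiset.singleton_add, mSize_add]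
    refine tensorDegree_mul ?_ ih
    rw [comul_gen]
    refine Submodule.sum_mem _ fun i hi => ?_
    obtain ⟨s, hs, hs'⟩ := exists_gen_eq (w.1.take i)
    obtain ⟨t, ht, ht'⟩ := exists_gen_eq (w.1.drop i)
    refine Submodule.subset_span ⟨s, t, ?_, by rw [hs', ht']⟩
    rw [hs, ht, mSize_singleton]
    simp at hi ⊢; omega

theorem exists_antipode : ∃ S : PSym A →ₗ[ℚ] PSym A,
    LinearMap.mul' ℚ (PSym A) ∘ₗ S.rTensor (PSym A) ∘ₗ Coalgebra.comul
      = Algebra.linearMap ℚ (PSym A) ∘ₗ Coalgebra.counit ∧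
    LinearMap.mul' ℚ (PSym A) ∘ₗ S.lTensor (PSym A) ∘ₗ Coalgebra.comul
      = Algebra.linearMap ℚ (PSym A) ∘ₗ Coalgebra.counit := by
  obtain ⟨b, hb⟩ := exists_basis_hM (A := A)
  have hb' : (b : Multiset (Word A) → PSym A) = hM := funext hb
  refine exists_convInverse b mSize (fun s => ?_) fun s hs => ?_
  · rw [hb']; exact comul_hM_mem s
  · rw [hb, mSize_eq_zero hs, hM_zero]

/-- The antipode of the connected graded bialgebra `PSym_A` (it is unique). -/
noncomputable instance : HopfAlgebra ℚ (PSym A) where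
  antipode := exists_antipode.choose
  mul_antipode_rTensor_comul := exists_antipode.choose_spec.1
  mul_antipode_lTensor_comul := exists_antipode.choose_spec.2

section
variable [LinearOrder A]

/-- `h_P = h_{w_1} ⋯ h_{w_k}` for a p-sentence `P = (w_1, …, w_k)`. -/
noncomputable def h (P : PSent A) : PSym A := (P.1.map fun w => gen w.1).prod

theorem h_eq (P : PSent A) : h P = hM P.toMultiset := by simp [h, hM, PSent.toMultiset]

/-- The basis `(h_P)` of `PSym_A`. -/
noncomputable def basisH : Module.Basis (PSent A) ℚ (PSym A) :=
  exists_basis_hM.choose.reindex PSent.equivMultiset.symm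

@[simp] theorem basisH_apply (P : PSent A) : basisH P = h P := by
  rw [basisH, Module.Basis.reindex_apply, exists_basis_hM.choose_spec, h_eq]; rfl
end

end PSym

/-- Monomials in the variables `x_{a,i}` (`a : A`, `i ≥ 1`), where two variables commute as soon as
their second indices differ: such a monomial is `x_{K 1,1} x_{K 2,2} ⋯` for a unique family of
words `K i`, all but finitely many of them empty, and two monomials are multiplied by
concatenating these words index by index. -/
@[ext]
structure Monom (A : Type*) where
  /-- The word of letters of index `i`. -/
  val : ℕ+ → FreeMonoid A
  finite : (Function.mulSupport val).Finite

namespace Monom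
variable {A : Type*}

noncomputable instance : One (Monom A) := ⟨⟨1, by simp [Function.mulSupport_one]⟩⟩

noncomputable instance : Mul (Monom A) :=
  ⟨fun K L => ⟨K.val * L.val, (K.finite.union L.finite).subset (Function.mulSupport_mul _ _)⟩⟩

noncomputable instance : Monoid (Monom A) where
  mul_assoc K L M := Monom.ext (mul_assoc K.val L.val M.val)
  one_mul K := Monom.ext (one_mul K.val)
  mul_one K := Monom.ext (mul_one K.val)

theorem mul_val (K L : Monom A) (i : ℕ+) : (K * L).1 i = K.1 i * L.1 i := rfl
theorem one_val (i : ℕ+) : (1 : Monom A).1 i = 1 := rfl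

/-- The indices that occur in a monomial. -/
noncomputable def supp (K : Monom A) : Finset ℕ+ := K.finite.toFinset

theorem mem_supp {K : Monom A} {i : ℕ+} : i ∈ K.supp ↔ K.1 i ≠ 1 := Set.Finite.mem_toFinset K.2

/-- The degree of a monomial. -/
noncomputable def deg (K : Monom A) : ℕ := ∑ i ∈ K.supp, (K.1 i).length

theorem deg_eq {K : Monom A} {s : Finset ℕ+} (h : K.supp ⊆ s) :
    K.deg = ∑ i ∈ s, (K.1 i).length := by
  refine Finset.sum_subset h fun i _ hi => ?_
  have : K.1 i = 1 := by simpa [mem_supp] using hi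
  rw [this]; rfl

theorem deg_mul (K L : Monom A) : (K * L).deg = K.deg + L.deg := by
  classical
  have h : (K * L).supp ⊆ K.supp ∪ L.supp := by
    intro i hi
    by_contra h
    simp only [Finset.mem_union, mem_supp, not_or, not_not] at h
    rw [mem_supp] at hi
    exact hi (by simp [mul_val, h.1, h.2])
  rw [deg_eq h, deg_eq (K := K) (s := K.supp ∪ L.supp) Finset.subset_union_left,
    deg_eq (K := L) (s := K.supp ∪ L.supp) Finset.subset_union_right, ← Finset.sum_add_distrib]
  exact Finset.sum_congr rfl fun i _ => FreeMonoid.length_mul _ _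

theorem finite_factorizations (K : Monom A) : {p : Monom A × Monom A | p.1 * p.2 = K}.Finite := by
  classical
  let ℓ : Monom A × Monom A → (ℕ+ →₀ ℕ) := fun p =>
    Finsupp.onFinset p.1.supp (fun i => (p.1.1 i).length) fun i hi => by
      rw [mem_supp]; intro h; simp [h] at hi
  let c : ℕ+ →₀ ℕ := Finsupp.onFinset K.supp (fun i => (K.1 i).length) fun i hi => by
      rw [mem_supp]; intro h; simp [h] at hi
  refine Set.Finite.of_finite_image (f := ℓ) ((Set.finite_Iic c).subset ?_) ?_
  · rintro _ ⟨p, hp, rfl⟩ i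
    change (p.1.1 i).length ≤ (K.1 i).length
    rw [← (show p.1 * p.2 = K from hp), mul_val]
    simp
  · rintro ⟨I, J⟩ hp ⟨I', J'⟩ hp' h
    have hI : ∀ i, I.1 i = I'.1 i ∧ J.1 i = J'.1 i := by
      intro i
      have h1 : (FreeMonoid.toList (I.1 i)).length = (FreeMonoid.toList (I'.1 i)).length :=
        DFunLike.congr_fun h i
      have h2 : I.1 i * J.1 i = I'.1 i * J'.1 i :=
        congrArg (fun M : Monom A => M.1 i) ((show I * J = K from hp).trans (show I' * J' = K from hp').symm)
      exact List.append_inj (s₁ := FreeMonoid.toList (I.1 i)) (s₂ := FreeMonoid.toList (I'.1 i)) h2 h1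
    exact Prod.ext (Monom.ext (funext fun i => (hI i).1)) (Monom.ext (funext fun i => (hI i).2))

/-- All factorizations of a monomial as a product of two monomials. -/
noncomputable def factorizations (K : Monom A) : Finset (Monom A × Monom A) :=
  (finite_factorizations K).toFinset

@[simp] theorem mem_factorizations {K : Monom A} {p : Monom A × Monom A} :
    p ∈ K.factorizations ↔ p.1 * p.2 = K := by simp [factorizations]

/-- The monomial obtained by renaming the second indices. -/
def rename (σ : Equiv.Perm ℕ+) (K : Monom A) : Monom A :=
  ⟨K.1 ∘ σ, by
    have : Function.mulSupport (K.1 ∘ σ) = σ ⁻¹' Function.mulSupport K.1 := rfl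
    rw [this]
    exact Set.Finite.preimage σ.injective.injOn K.2⟩

theorem rename_mul (σ : Equiv.Perm ℕ+) (K L : Monom A) :
    rename σ (K * L) = rename σ K * rename σ L := rfl

theorem rename_symm (σ : Equiv.Perm ℕ+) (K : Monom A) : rename σ (rename σ.symm K) = K :=
  Monom.ext (funext fun i => by simp [rename])

theorem rename_symm' (σ : Equiv.Perm ℕ+) (K : Monom A) : rename σ.symm (rename σ K) = K :=
  Monom.ext (funext fun i => by simp [rename])

theorem deg_one : (1 : Monom A).deg = 0 :=
  Finset.sum_eq_zero fun _ _ => rfl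

theorem deg_rename (σ : Equiv.Perm ℕ+) (K : Monom A) : (rename σ K).deg = K.deg := by
  classical
  refine Finset.sum_bij (fun i _ => σ i) ?_ ?_ ?_ ?_
  · intro i hi; rw [mem_supp] at hi ⊢; exact hi
  · intro i _ j _ h; exact σ.injective h
  · intro i hi; rw [mem_supp] at hi
    exact ⟨σ.symm i, by rw [mem_supp]; simpa [rename] using hi, by simp⟩
  · intro i _; rfl

/-- The sentence associated with a monomial: its non-empty words, by increasing index. -/
noncomputable def sentence (K : Monom A) : List (Word A) :=
  (K.supp.sort (· ≤ ·)).filterMap fun i => Word.toWord (FreeMonoid.toList (K.1 i))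

end Monom

/-- Formal power series over `ℚ` in the partially commuting variables `x_{a,i}`. -/
def ColoredPowerSeries (A : Type*) : Type _ := Monom A → ℚ

namespace ColoredPowerSeries
variable {A : Type*}

noncomputable instance : AddCommGroup (ColoredPowerSeries A) := Pi.addCommGroup
noncomputable instance : Module ℚ (ColoredPowerSeries A) := Pi.module _ _ _

/-- The coefficient of a monomial. -/
def coeff (K : Monom A) : ColoredPowerSeries A →ₗ[ℚ] ℚ := LinearMap.proj K

/-- The power series with given coefficients. -/
def mk (f : Monom A → ℚ) : ColoredPowerSeries A := f

@[simp] theorem coeff_mk (f : Monom A → ℚ) (K : Monom A) : coeff K (mk f) = f K := rfl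

@[ext] theorem ext {f g : ColoredPowerSeries A} (h : ∀ K, coeff K f = coeff K g) : f = g := funext h

open Classical in
noncomputable instance : One (ColoredPowerSeries A) := ⟨mk fun K => if K = 1 then 1 else 0⟩

noncomputable instance : Mul (ColoredPowerSeries A) :=
  ⟨fun f g => mk fun K => ∑ p ∈ K.factorizations, coeff p.1 f * coeff p.2 g⟩

open Classical in
theorem coeff_one (K : Monom A) : coeff K 1 = if K = 1 then 1 else 0 := rfl

theorem coeff_mul (K : Monom A) (f g : ColoredPowerSeries A) :
    coeff K (f * g) = ∑ p ∈ K.factorizations, coeff p.1 f * coeff p.2 g := rfl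

noncomputable instance : Ring (ColoredPowerSeries A) where
  __ := (inferInstance : AddCommGroup (ColoredPowerSeries A))
  left_distrib f g h := by
    ext K; simp only [coeff_mul, map_add, mul_add, Finset.sum_add_distrib]
  right_distrib f g h := by
    ext K; simp only [coeff_mul, map_add, add_mul, Finset.sum_add_distrib]
  zero_mul f := by ext K; simp [coeff_mul]
  mul_zero f := by ext K; simp [coeff_mul]
  one_mul f := by
    ext K
    rw [coeff_mul, Finset.sum_eq_single (1, K)]
    · simp [coeff_one]
    · rintro ⟨I, J⟩ h hne
      have : I ≠ 1 := by rintro rfl; apply hne; simp at h; simp [h]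
      simp [coeff_one, this]
    · simp
  mul_one f := by
    ext K
    rw [coeff_mul, Finset.sum_eq_single (K, 1)]
    · simp [coeff_one]
    · rintro ⟨I, J⟩ h hne
      have : J ≠ 1 := by rintro rfl; apply hne; simp at h; simp [h]
      simp [coeff_one, this]
    · simp
  mul_assoc f g h := by
    ext K
    simp only [coeff_mul, Finset.sum_mul, Finset.mul_sum]
    rw [Finset.sum_sigma', Finset.sum_sigma']
    refine Finset.sum_bij' (fun p _ => ⟨(p.2.1, p.2.2 * p.1.2), (p.2.2, p.1.2)⟩)
      (fun p _ => ⟨(p.1.1 * p.2.1, p.2.2), (p.1.1, p.2.1)⟩) ?_ ?_ ?_ ?_ ?_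
    · rintro ⟨⟨P, J⟩, ⟨I, I'⟩⟩ h; simp at h ⊢; rw [← h.1, ← h.2, mul_assoc]
    · rintro ⟨⟨P, J⟩, ⟨I, I'⟩⟩ h; simp at h ⊢; rw [← h.1, ← h.2, mul_assoc]
    · rintro ⟨⟨P, J⟩, ⟨I, I'⟩⟩ h; simp at h ⊢; rw [h.2]
    · rintro ⟨⟨P, J⟩, ⟨I, I'⟩⟩ h; simp at h ⊢; rw [h.2]
    · rintro ⟨⟨P, J⟩, ⟨I, I'⟩⟩ h; simp [mul_assoc]

noncomputable instance : Algebra ℚ (ColoredPowerSeries A) :=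
  Algebra.ofModule
    (fun r f g => by ext K; simp [coeff_mul, Finset.mul_sum, mul_assoc])
    (fun r f g => by ext K; simp [coeff_mul, Finset.mul_sum, mul_left_comm])

end ColoredPowerSeries

open ColoredPowerSeries in
/-- `Sym_A`: the colored symmetric functions, i.e. the power series of bounded degree that are
invariant under all permutations of the second indices of the variables. -/
noncomputable def SymA (A : Type*) : Subalgebra ℚ (ColoredPowerSeries A) where
  carrier := {f | (∀ (σ : Equiv.Perm ℕ+) (K : Monom A), coeff (K.rename σ) f = coeff K f) ∧
    ∃ N : ℕ, ∀ K : Monom A, N < K.deg → coeff K f = 0}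
  mul_mem' := by
    rintro f g ⟨hf, N, hN⟩ ⟨hg, M, hM⟩
    refine ⟨fun σ K => ?_, N + M, fun K hK => ?_⟩
    · rw [coeff_mul, coeff_mul]
      refine Finset.sum_bij' (fun p _ => (p.1.rename σ.symm, p.2.rename σ.symm))
        (fun p _ => (p.1.rename σ, p.2.rename σ)) ?_ ?_ ?_ ?_ ?_
      · rintro p hp
        simp only [Monom.mem_factorizations] at hp ⊢
        rw [← Monom.rename_mul, hp, Monom.rename_symm']
      · rintro p hp
        simp only [Monom.mem_factorizations] at hp ⊢
        rw [← Monom.rename_mul, hp]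
      · rintro p hp; simp [Monom.rename_symm]
      · rintro p hp; simp [Monom.rename_symm']
      · rintro p hp; simp only [hf, hg]
    · rw [coeff_mul]
      refine Finset.sum_eq_zero fun p hp => ?_
      rw [Monom.mem_factorizations] at hp
      rw [← hp, Monom.deg_mul] at hK
      rcases lt_or_ge N p.1.deg with h | h
      · rw [hN _ h, zero_mul]
      · rw [hM _ (by omega), mul_zero]
  add_mem' := by
    rintro f g ⟨hf, N, hN⟩ ⟨hg, M, hM⟩
    refine ⟨fun σ K => by simp only [map_add, hf, hg], max N M, fun K hK => ?_⟩
    rw [map_add, hN _ (by omega), hM _ (by omega), add_zero]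
  algebraMap_mem' r := by
    rw [Algebra.algebraMap_eq_smul_one]
    refine ⟨fun σ K => ?_, 0, fun K hK => ?_⟩
    · have : K.rename σ = 1 ↔ K = 1 :=
        ⟨fun h => by rw [← Monom.rename_symm' σ K, h]; rfl, fun h => by rw [h]; rfl⟩
      rw [map_smul, map_smul, coeff_one, coeff_one]
      by_cases h : K = 1
      · rw [if_pos h, if_pos (this.2 h)]
      · rw [if_neg h, if_neg (mt this.1 h)]
    · have : K ≠ 1 := by rintro rfl; rw [Monom.deg_one] at hK; omega
      simp [coeff_one, this]

namespace Monom
variable {A : Type*}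

/-- The multiset of non-empty words of a monomial. -/
noncomputable def words (K : Monom A) : Multiset (Word A) := (K.sentence : Multiset (Word A))

theorem words_eq (K : Monom A) : K.words =
    K.supp.val.filterMap fun i => Word.toWord (FreeMonoid.toList (K.1 i)) := by
  rw [words, sentence, ← Multiset.filterMap_coe, Finset.sort_eq]

theorem toWord_eq_some {l : List A} {w : Word A} : Word.toWord l = some w ↔ l = w.1 := by
  unfold Word.toWord
  split_ifs with h
  · simp only [Option.some.injEq]
    exact ⟨fun h => by rw [← h], fun h => Word.ext h⟩
  · simp only [false_iff]
    intro h'; exact w.2 (h' ▸ not_not.mp h)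

open Classical in
theorem count_words (K : Monom A) (w : Word A) :
    K.words.count w = Nat.card {i // K.1 i = FreeMonoid.ofList w.1} := by
  have h1 : K.words.count w = (K.supp.filter fun i => K.1 i = FreeMonoid.ofList w.1).card := by
    rw [words, sentence, Multiset.coe_count, List.count_filterMap,  Finset.card, Finset.filter_val,
      ← Multiset.countP_eq_card_filter, ← Finset.sort_eq (s := K.supp) (r := (· ≤ ·)),
      Multiset.coe_countP]
    refine List.countP_congr fun i _ => ?_
    rw [beq_iff_eq, toWord_eq_some, decide_eq_true_eq]; rfl
  rw [h1]
  refine (Nat.subtype_card _ fun i => ?_).symm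
  rw [Finset.mem_filter, mem_supp, and_iff_right_iff_imp]
  intro h h'
  exact w.2 (by rw [h'] at h; exact congrArg FreeMonoid.toList h.symm)

theorem finite_fiber (K : Monom A) (c : FreeMonoid A) (hc : c ≠ 1) :
    Finite {i // K.1 i = c} :=
  Set.Finite.subset K.2 fun i (hi : K.1 i = c) => by
    change K.1 i ≠ 1
    rwa [hi]

theorem infinite_fiber (K : Monom A) : Infinite {i // K.1 i = 1} := by
  have : ((Function.mulSupport K.1)ᶜ).Infinite := Set.Finite.infinite_compl K.2
  have h2 : (Function.mulSupport K.1)ᶜ = {i | K.1 i = 1} := by ext; simp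
  rw [h2] at this
  exact this.to_subtype

theorem exists_rename {K L : Monom A} (h : K.words = L.words) : ∃ σ, K = L.rename σ := by
  classical
  have e : ∀ c, Nonempty ({i // K.1 i = c} ≃ {i // L.1 i = c}) := by
    intro c
    by_cases hc : c = 1
    · subst hc
      have := infinite_fiber K
      have := infinite_fiber L
      exact nonempty_equiv_of_countable
    · have := finite_fiber K c hc
      have := finite_fiber L c hc
      have hc' : FreeMonoid.toList c ≠ [] := hc
      have := (count_words K ⟨FreeMonoid.toList c, hc'⟩).symm.trans
        ((congrArg _ h).trans (count_words L ⟨FreeMonoid.toList c, hc'⟩))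
      exact Finite.card_eq.1 this
  exact ⟨Equiv.ofFiberEquiv fun c => (e c).some,
    Monom.ext (funext fun i => (Equiv.ofFiberEquiv_map (fun c => (e c).some) i).symm)⟩

theorem words_rename (σ : Equiv.Perm ℕ+) (K : Monom A) : (K.rename σ).words = K.words := by
  classical
  ext w
  rw [count_words, count_words]
  exact Nat.card_congr (σ.subtypeEquiv fun i => Iff.rfl)

theorem deg_eq_mSize (K : Monom A) : K.deg = PSym.mSize K.words := by
  rw [deg, Finset.sum, words_eq, PSym.mSize]
  have : ∀ s : Multiset ℕ+, (s.map fun i => (K.1 i).length).sum =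
      (((s.filterMap fun i => Word.toWord (FreeMonoid.toList (K.1 i)))).map Word.size).sum := by
    intro s
    induction s using Multiset.induction with
    | empty => simp
    | cons i t ih =>
      rw [Multiset.map_cons, Multiset.sum_cons, ih]
      by_cases h : FreeMonoid.toList (K.1 i) = []
      · have h1 : Word.toWord (FreeMonoid.toList (K.1 i)) = none := by simp [Word.toWord, h]
        have h2 : (K.1 i).length = 0 := congrArg List.length h
        rw [Multiset.filterMap_cons_none (f := fun i => Word.toWord (FreeMonoid.toList (K.1 i))) _ _ h1, h2, zero_add]
      · have h1 : Word.toWord (FreeMonoid.toList (K.1 i)) = some ⟨_, h⟩ := by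
          simp [Word.toWord, h]
        rw [Multiset.filterMap_cons_some (fun i => Word.toWord (FreeMonoid.toList (K.1 i))) _ _ h1, Multiset.map_cons, Multiset.sum_cons]
        rfl
  exact this _

/-- A bijection between two copies of the index set and the index set. -/
noncomputable def splitEquiv : ℕ+ ⊕ ℕ+ ≃ ℕ+ := nonempty_equiv_of_countable.some

/-- The monomial in a doubled set of variables, seen as a monomial. -/
noncomputable def join (K L : Monom A) : Monom A :=
  ⟨fun i => Sum.elim K.1 L.1 (splitEquiv.symm i), by
    refine Set.Finite.subset (((Set.Finite.image (splitEquiv ∘ Sum.inl) K.2)).union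
      (Set.Finite.image (splitEquiv ∘ Sum.inr) L.2)) fun i hi => ?_
    obtain ⟨j, rfl⟩ := splitEquiv.surjective i
    rw [Function.mem_mulSupport, Equiv.symm_apply_apply] at hi
    rcases j with j | j
    · exact Or.inl ⟨j, hi, rfl⟩
    · exact Or.inr ⟨j, hi, rfl⟩⟩

/-- The part of a monomial in the first half of the variables. -/
noncomputable def left (K : Monom A) : Monom A :=
  ⟨fun i => K.1 (splitEquiv (Sum.inl i)),
    Set.Finite.preimage (f := splitEquiv ∘ Sum.inl)
      (splitEquiv.injective.comp Sum.inl_injective).injOn K.2⟩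

/-- The part of a monomial in the second half of the variables. -/
noncomputable def right (K : Monom A) : Monom A :=
  ⟨fun i => K.1 (splitEquiv (Sum.inr i)),
    Set.Finite.preimage (f := splitEquiv ∘ Sum.inr)
      (splitEquiv.injective.comp Sum.inr_injective).injOn K.2⟩

theorem join_left_right (K : Monom A) : join K.left K.right = K := by
  refine Monom.ext (funext fun i => ?_)
  obtain ⟨j, rfl⟩ := splitEquiv.surjective i
  rcases j with j | j <;> simp [join, left, right]

theorem left_join (K L : Monom A) : (join K L).left = K :=
  Monom.ext (funext fun i => by simp [join, left])

theorem right_join (K L : Monom A) : (join K L).right = L :=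
  Monom.ext (funext fun i => by simp [join, right])

theorem left_mul (K L : Monom A) : (K * L).left = K.left * L.left := rfl
theorem right_mul (K L : Monom A) : (K * L).right = K.right * L.right := rfl

theorem join_mul (K L K' L' : Monom A) : join K L * join K' L' = join (K * K') (L * L') := by
  rw [← join_left_right (join K L * join K' L')]
  simp only [left_mul, right_mul, left_join, right_join]

theorem words_join (K L : Monom A) : (join K L).words = K.words + L.words := by
  classical
  ext w
  rw [Multiset.count_add, count_words, count_words, count_words]
  have := finite_fiber K (FreeMonoid.ofList w.1) w.2
  have := finite_fiber L (FreeMonoid.ofList w.1) w.2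
  rw [← Nat.card_sum]
  refine Nat.card_congr (Equiv.trans (splitEquiv.symm.subtypeEquiv
    (q := fun j => Sum.elim K.1 L.1 j = FreeMonoid.ofList w.1) fun i => Iff.rfl) Equiv.subtypeSum)

theorem words_one : (1 : Monom A).words = 0 :=
  PSym.mSize_eq_zero (by rw [← deg_eq_mSize, deg_one])

theorem words_eq_zero {K : Monom A} (h : K.words = 0) : K = 1 := by
  obtain ⟨σ, hσ⟩ := exists_rename (h.trans words_one.symm)
  exact hσ

theorem exists_words_eq (s : Multiset (Word A)) : ∃ K : Monom A, K.words = s := by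
  classical
  induction s using Multiset.induction with
  | empty => exact ⟨1, words_one⟩
  | cons w t ih =>
    obtain ⟨L, rfl⟩ := ih
    let K : Monom A := ⟨fun i => if i = 1 then FreeMonoid.ofList w.1 else 1,
      (Set.finite_singleton 1).subset fun i hi => by
        by_contra h
        exact hi (if_neg h)⟩
    have hK : K.words = {w} := by
      have hs : K.supp = {1} := by
        ext i
        rw [mem_supp, Finset.mem_singleton]
        by_cases h : i = 1
        · simp only [K, h, if_true]
          exact iff_of_true w.2 trivial
        · simp [K, h]
      have h1 : Word.toWord (FreeMonoid.toList (K.1 1)) = some w := toWord_eq_some.2 rfl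
      rw [words_eq, hs, Finset.singleton_val, ← Multiset.cons_zero,
        Multiset.filterMap_cons_some (fun i => Word.toWord (FreeMonoid.toList (K.1 i))) _ _ h1]
      rfl
    exact ⟨join K L, by rw [words_join, hK, Multiset.singleton_add]⟩

end Monom

namespace PSent
variable {A : Type*} [LinearOrder A]

theorem size_sort (s : Multiset (Word A)) : (sort s).size = PSym.mSize s := by
  rw [size, toMultiset_sort]; rfl

theorem size_eq (P : PSent A) : P.size = PSym.mSize P.toMultiset := rfl

theorem sort_injective : Function.Injective (sort (A := A)) := equivMultiset.symm.injective

theorem eq_empty {P : PSent A} (h : P.size = 0) : P = empty := by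
  rw [← sort_toMultiset P, PSym.mSize_eq_zero h]; rfl

theorem finite_size_le [Finite A] (N : ℕ) : {P : PSent A | P.size ≤ N}.Finite := by
  classical
  have h1 : Finite {w : Word A // w.size ≤ N} := by
    have : Finite {l : List A // l.length ≤ N} := (List.finite_length_le A N).to_subtype
    exact Finite.of_injective
      (fun w : {w : Word A // w.size ≤ N} => (⟨w.1.val, w.2⟩ : {l : List A // l.length ≤ N}))
      fun v w h => Subtype.ext (Word.ext (congrArg Subtype.val h))
  have h2 := List.finite_length_le {w : Word A // w.size ≤ N} N
  refine ((h2.image fun l => sort ((l.map Subtype.val : List (Word A)) : Multiset (Word A)))).subset ?_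
  intro P hP
  have hP' : (P.val.map Word.size).sum ≤ N := by
    have : P.size ≤ N := hP
    simpa [size, toMultiset] using this
  have hmem : ∀ w ∈ P.val, w.size ≤ N := fun w hw =>
    (List.single_le_sum (by simp) _ (List.mem_map_of_mem hw)).trans hP'
  refine ⟨P.val.attach.map fun w => ⟨w.1, hmem w.1 w.2⟩, ?_, ?_⟩
  · have : P.val.length ≤ (P.val.map Word.size).sum := by
      have := List.length_le_sum_of_one_le (P.val.map Word.size) (by
        intro i hi
        obtain ⟨w, _, rfl⟩ := List.mem_map.1 hi
        exact w.size_pos)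
      simpa using this
    simpa using this.trans hP'
  · dsimp only
    rw [List.map_map]
    have : (Subtype.val ∘ fun w : {x // x ∈ P.val} =>
      (⟨w.1, hmem w.1 w.2⟩ : {w : Word A // w.size ≤ N})) = Subtype.val := rfl
    simp only [this, List.attach_map_subtype_val]
    exact sort_toMultiset P

theorem sum_sub {M : Type*} [AddCommMonoid M] (s : Multiset (Word A)) (F : PSent A → PSent A → M) :
    ∑ Q ∈ (sort s).sub, F Q ((sort s).diff Q) = ∑ t ∈ Finset.Iic s, F (sort t) (sort (s - t)) := by
  rw [sub, Finset.sum_map, toMultiset_sort]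
  refine Finset.sum_congr rfl fun t _ => ?_
  change F (sort t) (diff (sort s) (sort t)) = _
  rw [diff, toMultiset_sort, toMultiset_sort]

theorem sum_sub_ite (s t u : Multiset (Word A)) :
    (∑ Q ∈ (sort s).sub, (if Q = sort t then (1 : ℚ) else 0) *
      (if (sort s).diff Q = sort u then 1 else 0)) = if sort s = sort (t + u) then 1 else 0 := by
  rw [sum_sub s fun Q R => (if Q = sort t then (1 : ℚ) else 0) * (if R = sort u then 1 else 0)]
  simp only [sort_injective.eq_iff]
  by_cases h : s = t + u
  · subst h
    rw [Finset.sum_eq_single t]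
    · simp
    · intro x _ hx; simp [hx]
    · intro h; simp at h
  · rw [if_neg h]
    refine Finset.sum_eq_zero fun x hx => ?_
    by_cases hxt : x = t
    · subst hxt
      have : s - x ≠ u := by
        rintro rfl
        exact h (add_tsub_cancel_of_le (Finset.mem_Iic.1 hx)).symm
      simp [this]
    · simp [hxt]

end PSent

section Unshuffle
variable {A : Type*} [LinearOrder A] {X : Type*} [AddCommGroup X] [Module ℚ X]

/-- The coproduct `b_P ↦ ∑_{Q ⊑ P} b_Q ⊗ b_{P \ Q}` on a space with basis indexed by p-sentences. -/
noncomputable def unshuffle (b : Module.Basis (PSent A) ℚ X) : X →ₗ[ℚ] X ⊗[ℚ] X :=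
  b.constr ℚ fun P => ∑ Q ∈ P.sub, b Q ⊗ₜ[ℚ] b (P.diff Q)

/-- The counit: `1` on `b_∅` and `0` on the other basis elements. -/
noncomputable def unshuffleCounit (b : Module.Basis (PSent A) ℚ X) : X →ₗ[ℚ] ℚ :=
  b.constr ℚ fun P => if P = PSent.empty then 1 else 0

theorem unshuffle_basis (b : Module.Basis (PSent A) ℚ X) (P : PSent A) :
    unshuffle b (b P) = ∑ Q ∈ P.sub, b Q ⊗ₜ[ℚ] b (P.diff Q) := by
  rw [unshuffle, Module.Basis.constr_basis]

theorem unshuffle_sort (b : Module.Basis (PSent A) ℚ X) (s : Multiset (Word A)) :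
    unshuffle b (b (.sort s)) =
      ∑ t ∈ Finset.Iic s, b (.sort t) ⊗ₜ[ℚ] b (.sort (s - t)) := by
  rw [unshuffle_basis, PSent.sum_sub s fun Q R => b Q ⊗ₜ[ℚ] b R]

theorem unshuffleCounit_sort (b : Module.Basis (PSent A) ℚ X) (s : Multiset (Word A)) :
    unshuffleCounit b (b (.sort s)) = if s = 0 then 1 else 0 := by
  rw [unshuffleCounit, Module.Basis.constr_basis]
  simp only [PSent.empty, PSent.sort_injective.eq_iff]

/-- The coalgebra with these structure maps. -/
@[reducible] noncomputable def unshuffleCoalgebra (b : Module.Basis (PSent A) ℚ X) :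
    Coalgebra ℚ X where
  comul := unshuffle b
  counit := unshuffleCounit b
  coassoc := b.ext fun P => by
    obtain ⟨s, rfl⟩ := PSent.equivMultiset.symm.surjective P
    rw [show PSent.equivMultiset.symm s = PSent.sort s from rfl]
    simp only [LinearMap.comp_apply, unshuffle_sort, map_sum, LinearMap.rTensor_tmul,
      LinearMap.lTensor_tmul, TensorProduct.sum_tmul, TensorProduct.tmul_sum,
      LinearEquiv.coe_coe, TensorProduct.assoc_tmul]
    rw [Finset.sum_sigma', Finset.sum_sigma']
    refine Finset.sum_bij' (fun p _ => ⟨p.2, p.1 - p.2⟩) (fun p _ => ⟨p.1 + p.2, p.1⟩)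
      ?_ ?_ ?_ ?_ ?_
    · rintro ⟨t, u⟩ h
      simp only [Finset.mem_sigma, Finset.mem_Iic] at h ⊢
      exact ⟨h.2.trans h.1, tsub_le_tsub_right h.1 u⟩
    · rintro ⟨t, u⟩ h
      simp only [Finset.mem_sigma, Finset.mem_Iic] at h ⊢
      refine ⟨?_, le_self_add⟩
      rw [← add_tsub_cancel_of_le h.1]
      exact add_le_add_right h.2 t
    · rintro ⟨t, u⟩ h
      simp only [Finset.mem_sigma, Finset.mem_Iic] at h
      simp only [add_tsub_cancel_of_le h.2]
    · rintro ⟨t, u⟩ h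
      simp
    · rintro ⟨t, u⟩ h
      simp only [Finset.mem_sigma, Finset.mem_Iic] at h
      simp only [tsub_tsub, add_tsub_cancel_of_le h.2]
  rTensor_counit_comp_comul := b.ext fun P => by
    obtain ⟨s, rfl⟩ := PSent.equivMultiset.symm.surjective P
    rw [show PSent.equivMultiset.symm s = PSent.sort s from rfl]
    simp only [LinearMap.comp_apply, unshuffle_sort, map_sum, LinearMap.rTensor_tmul,
      unshuffleCounit_sort]
    rw [Finset.sum_eq_single 0]
    · simp
    · intro t _ ht; simp [ht]
    · intro h; exact absurd (Finset.mem_Iic.2 (zero_le)) h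
  lTensor_counit_comp_comul := b.ext fun P => by
    obtain ⟨s, rfl⟩ := PSent.equivMultiset.symm.surjective P
    rw [show PSent.equivMultiset.symm s = PSent.sort s from rfl]
    simp only [LinearMap.comp_apply, unshuffle_sort, map_sum, LinearMap.lTensor_tmul,
      unshuffleCounit_sort]
    rw [Finset.sum_eq_single s]
    · simp
    · intro t ht h
      have : s - t ≠ 0 := fun h' => h (le_antisymm (Finset.mem_Iic.1 ht) (tsub_eq_zero_iff_le.1 h'))
      simp [this]
    · simp

end Unshuffle

theorem unshuffle_antipode {A : Type*} [LinearOrder A] {X : Type*} [Ring X] [Bialgebra ℚ X]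
    (b : Module.Basis (PSent A) ℚ X) (hb : b .empty = 1)
    (hΔ : ∀ P, Coalgebra.comul (R := ℚ) (b P) = ∑ Q ∈ P.sub, b Q ⊗ₜ[ℚ] b (P.diff Q)) :
    ∃ S : X →ₗ[ℚ] X,
      LinearMap.mul' ℚ X ∘ₗ S.rTensor X ∘ₗ Coalgebra.comul
        = Algebra.linearMap ℚ X ∘ₗ Coalgebra.counit ∧
      LinearMap.mul' ℚ X ∘ₗ S.lTensor X ∘ₗ Coalgebra.comul
        = Algebra.linearMap ℚ X ∘ₗ Coalgebra.counit := by
  refine exists_convInverse b PSent.size (fun P => ?_) fun P hP => ?_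
  · rw [hΔ]
    refine Submodule.sum_mem _ fun Q hQ => Submodule.subset_span ⟨Q, P.diff Q, ?_, rfl⟩
    obtain ⟨t, ht, rfl⟩ := Finset.mem_map.1 hQ
    change (PSent.sort t).size + (P.diff (PSent.sort t)).size = _
    rw [PSent.diff, PSent.size_sort, PSent.size_sort, PSent.toMultiset_sort, ← PSym.mSize_add,
      add_tsub_cancel_of_le (Finset.mem_Iic.1 ht), PSent.size_eq]
  · rw [PSent.eq_empty hP, hb]

section TensorEval
variable {ι X : Type*} [AddCommGroup X] [Module ℚ X]

/-- `x ⊗ y ↦ α(x) β(y)`. -/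
noncomputable def tensorEval (α β : X →ₗ[ℚ] ℚ) : X ⊗[ℚ] X →ₗ[ℚ] ℚ :=
  LinearMap.mul' ℚ ℚ ∘ₗ TensorProduct.map α β

theorem tensorEval_tmul (α β : X →ₗ[ℚ] ℚ) (x y : X) : tensorEval α β (x ⊗ₜ y) = α x * β y := rfl

theorem tensorEval_ext (b : Module.Basis ι ℚ X) {t u : X ⊗[ℚ] X}
    (h : ∀ i j, tensorEval (b.coord i) (b.coord j) t = tensorEval (b.coord i) (b.coord j) u) :
    t = u := by
  refine (b.tensorProduct b).ext_elem fun p => ?_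
  have : ∀ t : X ⊗[ℚ] X,
      (b.tensorProduct b).repr t p = tensorEval (b.coord p.1) (b.coord p.2) t := by
    intro t
    induction t with
    | zero => simp
    | tmul f g =>
      rw [Module.Basis.tensorProduct_repr_tmul_apply, tensorEval_tmul, smul_eq_mul, mul_comm]; rfl
    | add x y hx hy => rw [map_add, map_add, Finsupp.add_apply, hx, hy]
  rw [this, this, h]

theorem tensorEval_unshuffle {A : Type*} [LinearOrder A] (b : Module.Basis (PSent A) ℚ X)
    (α β : X →ₗ[ℚ] ℚ) (s t u : Multiset (Word A))
    (hα : ∀ P, α (b P) = if P = .sort t then 1 else 0)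
    (hβ : ∀ P, β (b P) = if P = .sort u then 1 else 0) :
    tensorEval α β (unshuffle b (b (.sort s))) =
      if PSent.sort s = PSent.sort (t + u) then 1 else 0 := by
  rw [unshuffle_basis, map_sum]
  simp only [tensorEval_tmul, hα, hβ]
  exact PSent.sum_sub_ite s t u

end TensorEval

namespace SymA
open ColoredPowerSeries
variable {A : Type*}

theorem coeff_eq_of_words (f : SymA A) {K L : Monom A} (h : K.words = L.words) :
    coeff K f.1 = coeff L f.1 := by
  obtain ⟨σ, rfl⟩ := Monom.exists_rename h
  exact f.2.1 σ L

theorem coeff_one_mul (f g : ColoredPowerSeries A) :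
    coeff (1 : Monom A) (f * g) = coeff 1 f * coeff 1 g := by
  rw [coeff_mul, Finset.sum_eq_single (1, 1)]
  · rintro ⟨I, J⟩ h hne
    rw [Monom.mem_factorizations] at h
    have := congrArg Monom.deg h
    have hw := congrArg (fun K : Monom A => K.val) h
    have : ∀ i, I.val i = 1 ∧ J.val i = 1 := fun i => by
      have : FreeMonoid.toList (I.val i) ++ FreeMonoid.toList (J.val i) = [] := congrFun hw i
      exact List.append_eq_nil_iff.1 this
    exact absurd (Prod.ext (Monom.ext (funext fun i => (this i).1))
      (Monom.ext (funext fun i => (this i).2))) hne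
  · simp

/-- The coefficient of a monomial, as a linear form on `Sym_A`. -/
noncomputable def coeffL (K : Monom A) : SymA A →ₗ[ℚ] ℚ := coeff K ∘ₗ (SymA A).val.toLinearMap

/-- The coefficients of an element of `Sym_A ⊗ Sym_A` as a power series in two sets of variables. -/
noncomputable def coeff₂ (K L : Monom A) : SymA A ⊗[ℚ] SymA A →ₗ[ℚ] ℚ :=
  tensorEval (coeffL K) (coeffL L)

theorem coeff₂_tmul (K L : Monom A) (f g : SymA A) :
    coeff₂ K L (f ⊗ₜ g) = coeff K f.1 * coeff L g.1 := rfl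

variable [LinearOrder A]

/-- `m_P`: the sum of all monomials whose associated sentence sorts to the p-sentence `P`. -/
noncomputable def m (P : PSent A) : SymA A :=
  ⟨mk fun K => if PSent.sort (K.sentence : Multiset (Word A)) = P then 1 else 0, by
    refine ⟨fun σ K => ?_, P.size, fun K hK => ?_⟩
    · simp only [coeff_mk]
      rw [show ((K.rename σ).sentence : Multiset (Word A)) = K.sentence from Monom.words_rename σ K]
    · rw [coeff_mk, if_neg]
      rintro rfl
      rw [PSent.size_sort, Monom.deg_eq_mSize] at *
      exact lt_irrefl _ hK⟩

theorem coeff_m (K : Monom A) (P : PSent A) :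
    coeff K (m P).1 = if PSent.sort K.words = P then 1 else 0 := rfl

theorem m_empty : m (.empty : PSent A) = 1 := by
  classical
  refine Subtype.ext (ColoredPowerSeries.ext fun K => ?_)
  rw [coeff_m]
  refine Eq.trans ?_ (coeff_one K).symm
  exact if_congr ⟨fun h => Monom.words_eq_zero (PSent.sort_injective h),
    fun h => h ▸ congrArg _ Monom.words_one⟩ rfl rfl

/-- A monomial with associated p-sentence `P`. -/
noncomputable def rep (P : PSent A) : Monom A := (Monom.exists_words_eq P.toMultiset).choose

theorem words_rep (P : PSent A) : (rep P).words = P.toMultiset :=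
  (Monom.exists_words_eq P.toMultiset).choose_spec

theorem coeff_rep (f : SymA A) (K : Monom A) : coeff (rep (.sort K.words)) f.1 = coeff K f.1 :=
  coeff_eq_of_words f (by rw [words_rep, PSent.toMultiset_sort])

variable [Finite A]

theorem finite_coeff (f : SymA A) : {P : PSent A | coeff (rep P) f.1 ≠ 0}.Finite := by
  obtain ⟨N, hN⟩ := f.2.2
  refine (PSent.finite_size_le N).subset fun P hP => ?_
  by_contra h
  refine hP (hN _ ?_)
  rw [Monom.deg_eq_mSize, words_rep]
  exact not_le.1 h

/-- The coordinates of a colored symmetric function with respect to the `m_P`. -/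
noncomputable def repr : SymA A ≃ₗ[ℚ] (PSent A →₀ ℚ) where
  toFun f := Finsupp.ofSupportFinite (fun P => coeff (rep P) f.1) (finite_coeff f)
  map_add' f g := by ext P; exact map_add (coeff (rep P)) f.1 g.1
  map_smul' r f := by ext P; exact map_smul (coeff (rep P)) r f.1
  invFun c := ⟨mk fun K => c (.sort K.words), by
    refine ⟨fun σ K => ?_, c.support.sup PSent.size, fun K hK => ?_⟩
    · simp only [coeff_mk, Monom.words_rename]
    · rw [coeff_mk]
      by_contra h
      have := Finset.le_sup (f := PSent.size) (Finsupp.mem_support_iff.2 h)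
      rw [PSent.size_sort, ← Monom.deg_eq_mSize] at this
      omega⟩
  left_inv f := Subtype.ext (ColoredPowerSeries.ext fun K => coeff_rep f K)
  right_inv c := by
    ext P
    change c (.sort (rep P).words) = c P
    rw [words_rep, PSent.sort_toMultiset]

theorem repr_apply (f : SymA A) (P : PSent A) : repr f P = coeff (rep P) f.1 := rfl

/-- The basis `(m_P)` of `Sym_A`. -/
noncomputable def basisM : Module.Basis (PSent A) ℚ (SymA A) := .ofRepr repr

@[simp] theorem basisM_apply (P : PSent A) : basisM P = m P := by
  refine Subtype.ext (ColoredPowerSeries.ext fun K => ?_)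
  change (Finsupp.single P (1 : ℚ)) (.sort K.words) = _
  rw [coeff_m, Finsupp.single_apply]
  exact if_congr eq_comm rfl rfl

/-- `Δ(m_P) = ∑_{Q ⊑ P} m_Q ⊗ m_{P \ Q}`, `ε(m_∅) = 1` and `ε(m_P) = 0` otherwise. -/
noncomputable instance : Coalgebra ℚ (SymA A) := unshuffleCoalgebra basisM

theorem comul_m (P : PSent A) :
    Coalgebra.comul (R := ℚ) (m P) = ∑ Q ∈ P.sub, m Q ⊗ₜ[ℚ] m (P.diff Q) := by
  have := unshuffle_basis basisM P
  simp only [basisM_apply] at this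
  exact this

theorem ext₂ {t u : SymA A ⊗[ℚ] SymA A} (h : ∀ K L, coeff₂ K L t = coeff₂ K L u) : t = u :=
  tensorEval_ext basisM fun P Q => h (rep P) (rep Q)

theorem coeffL_m (K : Monom A) (P : PSent A) :
    coeffL K (basisM P) = if P = .sort K.words then 1 else 0 := by
  rw [basisM_apply]
  exact (coeff_m K P).trans (if_congr eq_comm rfl rfl)

theorem coeff₂_comul (K L : Monom A) (f : SymA A) :
    coeff₂ K L (Coalgebra.comul f) = coeff (K.join L) f.1 := by
  have : coeff₂ K L ∘ₗ unshuffle basisM = coeffL (K.join L) := by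
    refine basisM.ext fun P => ?_
    rw [LinearMap.comp_apply, coeffL_m, Monom.words_join, ← PSent.sort_toMultiset P]
    exact tensorEval_unshuffle basisM _ _ _ _ _ (coeffL_m K) (coeffL_m L)
  exact LinearMap.congr_fun this f

theorem coeff₂_mul (K L : Monom A) (t u : SymA A ⊗[ℚ] SymA A) :
    coeff₂ K L (t * u) = ∑ p ∈ K.factorizations, ∑ q ∈ L.factorizations,
      coeff₂ p.1 q.1 t * coeff₂ p.2 q.2 u := by
  induction t with
  | zero => simp
  | add x y hx hy => simp only [add_mul, map_add, hx, hy, Finset.sum_add_distrib]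
  | tmul f g =>
    induction u with
    | zero => simp
    | add x y hx hy => simp only [mul_add, map_add, hx, hy, Finset.sum_add_distrib]
    | tmul f' g' =>
      rw [Algebra.TensorProduct.tmul_mul_tmul, coeff₂_tmul]
      change coeff K (f.1 * f'.1) * coeff L (g.1 * g'.1) = _
      rw [coeff_mul, coeff_mul, Finset.sum_mul_sum]
      simp only [coeff₂_tmul]
      exact Finset.sum_congr rfl fun p _ => Finset.sum_congr rfl fun q _ => by ring

theorem comul_mul' (f g : SymA A) :
    Coalgebra.comul (R := ℚ) (f * g) = Coalgebra.comul f * Coalgebra.comul g := by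
  refine ext₂ fun K L => ?_
  rw [coeff₂_comul, coeff₂_mul]
  simp only [coeff₂_comul]
  change coeff (K.join L) (f.1 * g.1) = _
  rw [coeff_mul, ← Finset.sum_product']
  refine Finset.sum_bij' (fun p _ => ((p.1.left, p.2.left), (p.1.right, p.2.right)))
    (fun r _ => (r.1.1.join r.2.1, r.1.2.join r.2.2)) ?_ ?_ ?_ ?_ ?_
  · rintro ⟨I, J⟩ h
    simp only [Finset.mem_product, Monom.mem_factorizations] at h ⊢
    rw [← Monom.left_mul, ← Monom.right_mul, h, Monom.left_join, Monom.right_join]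
    exact ⟨rfl, rfl⟩
  · rintro ⟨⟨I, J⟩, ⟨I', J'⟩⟩ h
    simp only [Finset.mem_product, Monom.mem_factorizations] at h ⊢
    rw [Monom.join_mul, h.1, h.2]
  · rintro ⟨I, J⟩ _; simp only [Monom.join_left_right]
  · rintro ⟨⟨I, J⟩, ⟨I', J'⟩⟩ _; simp only [Monom.left_join, Monom.right_join]
  · rintro ⟨I, J⟩ _; simp only [Monom.join_left_right]

theorem counit_eq (f : SymA A) : Coalgebra.counit (R := ℚ) f = coeff 1 f.1 := by
  have : unshuffleCounit basisM = coeffL (1 : Monom A) := by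
    refine basisM.ext fun P => ?_
    rw [coeffL_m, unshuffleCounit, Module.Basis.constr_basis, Monom.words_one]
    rfl
  exact LinearMap.congr_fun this f

noncomputable instance : Bialgebra ℚ (SymA A) :=
  Bialgebra.mk' ℚ (SymA A)
    (by rw [counit_eq]; exact (coeff_one (1 : Monom A)).trans (if_pos rfl))
    (fun {f g} => by rw [counit_eq, counit_eq, counit_eq]; exact coeff_one_mul f.1 g.1)
    (by
      rw [← m_empty, comul_m, PSent.empty, PSent.sum_sub 0 fun Q R => m Q ⊗ₜ[ℚ] m R]
      have : Finset.Iic (0 : Multiset (Word A)) = {0} := by ext x; simp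
      rw [this, Finset.sum_singleton, tsub_self]
      change m PSent.empty ⊗ₜ[ℚ] m PSent.empty = _
      rw [m_empty]; rfl)
    (fun {f g} => comul_mul' f g)

theorem exists_antipode : ∃ S : SymA A →ₗ[ℚ] SymA A,
    LinearMap.mul' ℚ (SymA A) ∘ₗ S.rTensor (SymA A) ∘ₗ Coalgebra.comul
      = Algebra.linearMap ℚ (SymA A) ∘ₗ Coalgebra.counit ∧
    LinearMap.mul' ℚ (SymA A) ∘ₗ S.lTensor (SymA A) ∘ₗ Coalgebra.comul
      = Algebra.linearMap ℚ (SymA A) ∘ₗ Coalgebra.counit :=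
  unshuffle_antipode basisM (by rw [basisM_apply, m_empty]) fun P =>
    unshuffle_basis basisM P

/-- The antipode of the connected graded bialgebra `Sym_A` (it is unique). -/
noncomputable instance : HopfAlgebra ℚ (SymA A) where
  antipode := exists_antipode.choose
  mul_antipode_rTensor_comul := exists_antipode.choose_spec.1
  mul_antipode_lTensor_comul := exists_antipode.choose_spec.2

end SymA

namespace PSym
variable {A : Type*} [LinearOrder A]

/-- The homogeneous component of degree `n`, spanned by the `h_P` with `|P| = n`. -/
noncomputable def homogeneous (A : Type*) [LinearOrder A] (n : ℕ) : Submodule ℚ (PSym A) :=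
  Submodule.span ℚ {x | ∃ P : PSent A, P.size = n ∧ x = h P}

theorem h_sort (s : Multiset (Word A)) : h (.sort s) = hM s := by
  rw [h_eq, PSent.toMultiset_sort]

theorem h_mem (P : PSent A) : h P ∈ homogeneous A P.size := Submodule.subset_span ⟨P, rfl, rfl⟩

theorem conv_eq_zero {φ ψ : WithConv (PSym A →ₗ[ℚ] ℚ)} {N M n : ℕ}
    (hφ : ∀ k, N < k → ∀ x ∈ homogeneous A k, φ x = 0)
    (hψ : ∀ k, M < k → ∀ x ∈ homogeneous A k, ψ x = 0) (hn : N + M < n)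
    (x : PSym A) (hx : x ∈ homogeneous A n) : (φ * ψ) x = 0 := by
  have key : ∀ t ∈ tensorDegree (hM (A := A)) mSize n,
      LinearMap.mul' ℚ ℚ (TensorProduct.map φ.ofConv ψ.ofConv t) = 0 := by
    intro t ht
    induction ht using Submodule.span_induction with
    | mem t ht =>
      obtain ⟨u, v, huv, rfl⟩ := ht
      rw [TensorProduct.map_tmul, LinearMap.mul'_apply]
      rw [← h_sort, ← h_sort]
      rcases lt_or_ge N (mSize u) with h1 | h1
      · have : φ.ofConv (h (.sort u)) = 0 :=
          hφ _ h1 _ (PSent.size_sort u ▸ h_mem (PSent.sort u))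
        rw [this, zero_mul]
      · have : ψ.ofConv (h (.sort v)) = 0 :=
          hψ (mSize v) (by omega) _ (PSent.size_sort v ▸ h_mem (PSent.sort v))
        rw [this, mul_zero]
    | zero => simp
    | add x y _ _ hx hy => rw [map_add, map_add, hx, hy, add_zero]
    | smul c x _ hx => rw [map_smul, map_smul, hx, smul_zero]
  induction hx using Submodule.span_induction with
  | mem x hx =>
    obtain ⟨P, hP, rfl⟩ := hx
    rw [LinearMap.convMul_apply, h_eq]
    refine key _ ?_
    rw [← hP, PSent.size_eq]
    exact comul_hM_mem _
  | zero => exact map_zero (φ * ψ).ofConv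
  | add x y _ _ hx hy => exact (map_add (φ * ψ).ofConv x y).trans (by
      rw [show (φ * ψ).ofConv x = 0 from hx, show (φ * ψ).ofConv y = 0 from hy, add_zero])
  | smul c x _ hx => exact (map_smul (φ * ψ).ofConv c x).trans (by
      rw [show (φ * ψ).ofConv x = 0 from hx, smul_zero])

theorem counit_hM (s : Multiset (Word A)) :
    Coalgebra.counit (R := ℚ) (hM s) = if s = 0 then 1 else 0 := by
  induction s using Multiset.induction with
  | empty => rw [hM_zero, Bialgebra.counit_one, if_pos rfl]
  | cons w t _ =>
    rw [hM_cons, Bialgebra.counit_mul, counit_gen, if_neg w.ne_nil, zero_mul,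
      if_neg (Multiset.cons_ne_zero)]

theorem counit_eq_zero {n : ℕ} (hn : 0 < n) (x : PSym A) (hx : x ∈ homogeneous A n) :
    Coalgebra.counit (R := ℚ) x = 0 := by
  induction hx using Submodule.span_induction with
  | mem x hx =>
    obtain ⟨P, hP, rfl⟩ := hx
    rw [h_eq, counit_hM, if_neg]
    intro h0
    rw [PSent.size_eq, h0] at hP
    simp [mSize] at hP
    omega
  | zero => exact map_zero _
  | add x y _ _ hx hy => rw [map_add, hx, hy, add_zero]
  | smul c x _ hx => rw [map_smul, hx, smul_zero]

end PSym

/-- The graded dual of `PSym_A`: the linear forms on `PSym_A` that vanish on all but finitely many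
homogeneous components, with the convolution product `(φψ)(x) = (φ ⊗ ψ)(Δ x)`, whose unit is the
counit of `PSym_A`. -/
noncomputable def gradedDualSubalgebra (A : Type*) [LinearOrder A] :
    Subalgebra ℚ (WithConv (PSym A →ₗ[ℚ] ℚ)) where
  carrier := {φ | ∃ N : ℕ, ∀ n, N < n → ∀ x ∈ PSym.homogeneous A n, φ x = 0}
  mul_mem' := by
    rintro φ ψ ⟨N, hN⟩ ⟨M, hM⟩
    exact ⟨N + M, fun n hn x hx => PSym.conv_eq_zero hN hM hn x hx⟩
  add_mem' := by
    rintro φ ψ ⟨N, hN⟩ ⟨M, hM⟩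
    refine ⟨max N M, fun n hn x hx => ?_⟩
    change φ x + ψ x = 0
    rw [hN n (by omega) x hx, hM n (by omega) x hx, add_zero]
  algebraMap_mem' r := by
    refine ⟨0, fun n hn x hx => ?_⟩
    rw [LinearMap.convAlgebraMap_apply, PSym.counit_eq_zero hn x hx]
    simp

/-- The graded dual of `PSym_A`, as a type. -/
def GradedDual (A : Type*) [LinearOrder A] : Type _ := gradedDualSubalgebra A

namespace GradedDual
variable {A : Type*} [LinearOrder A]

noncomputable instance : Ring (GradedDual A) := inferInstanceAs (Ring (gradedDualSubalgebra A))
noncomputable instance : Algebra ℚ (GradedDual A) :=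
  inferInstanceAs (Algebra ℚ (gradedDualSubalgebra A))

/-- The underlying linear form. -/
noncomputable def toForm (A : Type*) [LinearOrder A] : GradedDual A →ₗ[ℚ] PSym A →ₗ[ℚ] ℚ :=
  (WithConv.linearEquiv ℚ (PSym A →ₗ[ℚ] ℚ)).toLinearMap ∘ₗ
    (gradedDualSubalgebra A).val.toLinearMap

/-- Evaluation `⟨x, φ⟩ = φ(x)`. -/
noncomputable def eval (A : Type*) [LinearOrder A] : PSym A →ₗ[ℚ] GradedDual A →ₗ[ℚ] ℚ :=
  (toForm A).flip

theorem eval_apply (x : PSym A) (φ : GradedDual A) : eval A x φ = toForm A φ x := rfl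

theorem ext_h {φ ψ : GradedDual A} (h : ∀ P, eval A (PSym.h P) φ = eval A (PSym.h P) ψ) : φ = ψ := by
  refine Subtype.ext ?_
  have : toForm A φ = toForm A ψ := PSym.basisH.ext fun P => by
    rw [PSym.basisH_apply]; exact h P
  exact congrArg WithConv.toConv this

/-- The linear form with prescribed values on the `h_P`, almost all zero. -/
noncomputable def ofValues (c : PSent A →₀ ℚ) : GradedDual A :=
  ⟨WithConv.toConv (PSym.basisH.constr ℚ c), c.support.sup PSent.size, fun n hn x hx => by
    change PSym.basisH.constr ℚ c x = 0
    induction hx using Submodule.span_induction with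
    | mem x hx =>
      obtain ⟨P, hP, rfl⟩ := hx
      rw [← PSym.basisH_apply, Module.Basis.constr_basis]
      by_contra h
      have := Finset.le_sup (f := PSent.size) (Finsupp.mem_support_iff.2 h)
      omega
    | zero => exact map_zero _
    | add x y _ _ hx hy => rw [map_add, hx, hy, add_zero]
    | smul c x _ hx => rw [map_smul, hx, smul_zero]⟩

theorem eval_ofValues (c : PSent A →₀ ℚ) (P : PSent A) :
    eval A (PSym.h P) (ofValues c) = c P := by
  change PSym.basisH.constr ℚ c (PSym.h P) = c P
  rw [← PSym.basisH_apply, Module.Basis.constr_basis]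

/-- The form `h*_P` with `h*_P(h_Q) = δ_{P,Q}`. -/
noncomputable def hStar (P : PSent A) : GradedDual A := ofValues (Finsupp.single P 1)

theorem eval_hStar (P Q : PSent A) :
    eval A (PSym.h Q) (hStar P) = if P = Q then 1 else 0 := by
  rw [hStar, eval_ofValues, Finsupp.single_apply]

variable [Finite A]

theorem finite_values (φ : GradedDual A) : {P : PSent A | eval A (PSym.h P) φ ≠ 0}.Finite := by
  obtain ⟨N, hN⟩ := φ.2
  refine (PSent.finite_size_le N).subset fun P hP => ?_
  by_contra h
  exact hP (hN P.size (not_le.1 h) _ (PSym.h_mem P))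

/-- The basis `(h*_P)` of the graded dual. -/
noncomputable def basisStar : Module.Basis (PSent A) ℚ (GradedDual A) := .ofRepr
  { toFun := fun φ => Finsupp.ofSupportFinite (fun P => eval A (PSym.h P) φ) (finite_values φ)
    map_add' := fun φ ψ => by ext P; exact map_add (eval A (PSym.h P)) φ ψ
    map_smul' := fun r φ => by ext P; exact map_smul (eval A (PSym.h P)) r φ
    invFun := ofValues
    left_inv := fun φ => ext_h fun P => eval_ofValues _ P
    right_inv := fun c => by ext P; exact eval_ofValues c P }

@[simp] theorem basisStar_apply (P : PSent A) : basisStar P = hStar P := rfl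

theorem coord_basisStar (P : PSent A) : basisStar.coord P = eval A (PSym.h P) := rfl

/-- `Δ(h*_P) = ∑_{Q ⊑ P} h*_Q ⊗ h*_{P \ Q}` and `ε(φ) = φ(1)`. This coproduct is the transpose of
the multiplication of `PSym_A`, see `eval_comul`. -/
noncomputable instance : Coalgebra ℚ (GradedDual A) := unshuffleCoalgebra basisStar

theorem eval_hStar_sort (s : Multiset (Word A)) (P : PSent A) :
    eval A (PSym.hM s) (basisStar P) = if P = .sort s then 1 else 0 := by
  rw [← PSym.h_sort]; exact eval_hStar _ _

theorem eval_comul (x y : PSym A) (φ : GradedDual A) :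
    tensorEval (eval A x) (eval A y) (Coalgebra.comul φ) = eval A (x * y) φ := by
  obtain ⟨b, hb⟩ := PSym.exists_basis_hM (A := A)
  have h1 : ∀ s t, tensorEval (eval A (PSym.hM s)) (eval A (PSym.hM t)) ∘ₗ unshuffle basisStar =
      eval A (PSym.hM s * PSym.hM t) := by
    intro s t
    refine basisStar.ext fun P => ?_
    rw [← PSent.sort_toMultiset P, LinearMap.comp_apply,
      tensorEval_unshuffle basisStar _ _ _ s t (eval_hStar_sort s) (eval_hStar_sort t),
      ← PSym.hM_add, eval_hStar_sort]
  have hx : x ∈ Submodule.span ℚ (Set.range b) := b.mem_span x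
  have hy : y ∈ Submodule.span ℚ (Set.range b) := b.mem_span y
  have add_left : ∀ (α α' β : GradedDual A →ₗ[ℚ] ℚ) t,
      tensorEval (α + α') β t = tensorEval α β t + tensorEval α' β t := by
    intro α α' β t
    simp [tensorEval, TensorProduct.map_add_left]
  have add_right : ∀ (α β β' : GradedDual A →ₗ[ℚ] ℚ) t,
      tensorEval α (β + β') t = tensorEval α β t + tensorEval α β' t := by
    intro α β β' t
    simp [tensorEval, TensorProduct.map_add_right]
  have smul_left : ∀ (r : ℚ) (α β : GradedDual A →ₗ[ℚ] ℚ) t,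
      tensorEval (r • α) β t = r * tensorEval α β t := by
    intro r α β t
    simp [tensorEval, TensorProduct.map_smul_left]
  have smul_right : ∀ (r : ℚ) (α β : GradedDual A →ₗ[ℚ] ℚ) t,
      tensorEval α (r • β) t = r * tensorEval α β t := by
    intro r α β t
    simp [tensorEval, TensorProduct.map_smul_right]
  induction hx using Submodule.span_induction with
  | mem x hx =>
    obtain ⟨s, rfl⟩ := hx
    induction hy using Submodule.span_induction with
    | mem y hy =>
      obtain ⟨t, rfl⟩ := hy
      rw [hb, hb]
      exact LinearMap.congr_fun (h1 s t) φ
    | zero => simp [tensorEval]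
    | add y y' _ _ hy hy' => rw [map_add, add_right, hy, hy', mul_add, map_add]; rfl
    | smul r y _ hy => rw [map_smul, smul_right, hy, mul_smul_comm, map_smul]; rfl
  | zero => simp [tensorEval]
  | add x x' _ _ hx hx' => rw [map_add, add_left, hx, hx', add_mul, map_add]; rfl
  | smul r x _ hx => rw [map_smul, smul_left, hx, smul_mul_assoc, map_smul]; rfl

theorem counit_eq (φ : GradedDual A) : Coalgebra.counit (R := ℚ) φ = eval A 1 φ := by
  have : unshuffleCounit basisStar = eval A 1 := by
    refine basisStar.ext fun P => ?_
    rw [unshuffleCounit, Module.Basis.constr_basis, ← PSym.hM_zero, eval_hStar_sort]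
    rfl
  exact LinearMap.congr_fun this φ

theorem eval_mul {ι : Type*} {x : PSym A} (r : Coalgebra.Repr ℚ x ι) (φ ψ : GradedDual A) :
    eval A x (φ * ψ) = ∑ i ∈ r.index, eval A (r.left i) φ * eval A (r.right i) ψ :=
  r.convMul_apply φ.1 ψ.1

theorem tensorEval_mul {ι κ : Type*} {x y : PSym A} (r : Coalgebra.Repr ℚ x ι)
    (q : Coalgebra.Repr ℚ y κ) (t u : GradedDual A ⊗[ℚ] GradedDual A) :
    tensorEval (eval A x) (eval A y) (t * u) = ∑ i ∈ r.index, ∑ j ∈ q.index,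
      tensorEval (eval A (r.left i)) (eval A (q.left j)) t *
        tensorEval (eval A (r.right i)) (eval A (q.right j)) u := by
  induction t with
  | zero => simp
  | add x y hx hy => simp only [add_mul, map_add, hx, hy, Finset.sum_add_distrib]
  | tmul f g =>
    induction u with
    | zero => simp
    | add x y hx hy => simp only [mul_add, map_add, hx, hy, Finset.sum_add_distrib]
    | tmul f' g' =>
      rw [Algebra.TensorProduct.tmul_mul_tmul, tensorEval_tmul, eval_mul r, eval_mul q,
        Finset.sum_mul_sum]
      simp only [tensorEval_tmul]
      exact Finset.sum_congr rfl fun _ _ => Finset.sum_congr rfl fun _ _ => by ring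

theorem comul_mul' (φ ψ : GradedDual A) :
    Coalgebra.comul (R := ℚ) (φ * ψ) = Coalgebra.comul φ * Coalgebra.comul ψ := by
  refine tensorEval_ext basisStar fun P Q => ?_
  rw [coord_basisStar, coord_basisStar]
  generalize PSym.h P = x
  generalize PSym.h Q = y
  let r := Coalgebra.Repr.arbitrary ℚ x
  let q := Coalgebra.Repr.arbitrary ℚ y
  rw [eval_comul, tensorEval_mul r q]
  simp only [eval_comul]
  have hxy : Coalgebra.comul (R := ℚ) (x * y) = ∑ i ∈ r.index, ∑ j ∈ q.index,
      (r.left i * q.left j) ⊗ₜ[ℚ] (r.right i * q.right j) := by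
    rw [Bialgebra.comul_mul, ← r.eq, ← q.eq, Finset.sum_mul_sum]
    simp only [Algebra.TensorProduct.tmul_mul_tmul]
  change LinearMap.mul' ℚ ℚ (TensorProduct.map (toForm A φ) (toForm A ψ) (Coalgebra.comul (x * y))) = _
  rw [hxy]
  simp only [map_sum, TensorProduct.map_tmul, LinearMap.mul'_apply]
  rfl

theorem eval_one (x : PSym A) : eval A x 1 = Coalgebra.counit x := rfl

theorem hStar_empty : hStar (.empty : PSent A) = 1 := by
  refine ext_h fun P => ?_
  rw [eval_hStar, eval_one, PSym.h_eq, PSym.counit_hM]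
  refine if_congr ⟨fun h => ?_, fun h => ?_⟩ rfl rfl
  · rw [← h, PSent.empty, PSent.toMultiset_sort]
  · rw [PSent.empty, ← h, PSent.sort_toMultiset]

noncomputable instance : Bialgebra ℚ (GradedDual A) :=
  Bialgebra.mk' ℚ (GradedDual A)
    (by rw [counit_eq, eval_one, Bialgebra.counit_one])
    (fun {φ ψ} => by
      rw [counit_eq, counit_eq, counit_eq]
      change LinearMap.mul' ℚ ℚ (TensorProduct.map (toForm A φ) (toForm A ψ) (Coalgebra.comul 1)) = _
      rw [Bialgebra.comul_one]; rfl)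
    (by
      refine tensorEval_ext basisStar fun P Q => ?_
      rw [coord_basisStar, coord_basisStar, eval_comul, eval_one, Bialgebra.counit_mul]
      rfl)
    (fun {φ ψ} => comul_mul' φ ψ)

theorem exists_antipode : ∃ S : GradedDual A →ₗ[ℚ] GradedDual A,
    LinearMap.mul' ℚ (GradedDual A) ∘ₗ S.rTensor (GradedDual A) ∘ₗ Coalgebra.comul
      = Algebra.linearMap ℚ (GradedDual A) ∘ₗ Coalgebra.counit ∧
    LinearMap.mul' ℚ (GradedDual A) ∘ₗ S.lTensor (GradedDual A) ∘ₗ Coalgebra.comul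
      = Algebra.linearMap ℚ (GradedDual A) ∘ₗ Coalgebra.counit :=
  unshuffle_antipode basisStar (by rw [basisStar_apply, hStar_empty]) fun P =>
    unshuffle_basis basisStar P

/-- The antipode of the graded dual (it is unique). -/
noncomputable instance : HopfAlgebra ℚ (GradedDual A) where
  antipode := exists_antipode.choose
  mul_antipode_rTensor_comul := exists_antipode.choose_spec.1
  mul_antipode_lTensor_comul := exists_antipode.choose_spec.2

end GradedDual

section DuallyPaired
variable {B C : Type*} [Ring B] [HopfAlgebra ℚ B] [Ring C] [HopfAlgebra ℚ C]

/-- The pairing `⟨b₁ ⊗ b₂, c₁ ⊗ c₂⟩ = ⟨b₁, c₁⟩ ⟨b₂, c₂⟩` induced by a bilinear form. -/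
noncomputable def tensorPairing (β : B →ₗ[ℚ] C →ₗ[ℚ] ℚ) : B ⊗[ℚ] B →ₗ[ℚ] C ⊗[ℚ] C →ₗ[ℚ] ℚ :=
  TensorProduct.dualDistrib ℚ C C ∘ₗ TensorProduct.map β β

/-- Two Hopf algebras are dually paired by the bilinear form `β`: multiplication and unit of each
are adjoint to comultiplication and counit of the other, and the antipodes are adjoint. -/
structure IsDuallyPaired (β : B →ₗ[ℚ] C →ₗ[ℚ] ℚ) : Prop where
  mul_left : ∀ b₁ b₂ c, β (b₁ * b₂) c = tensorPairing β (b₁ ⊗ₜ b₂) (Coalgebra.comul c)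
  one_left : ∀ c, β 1 c = Coalgebra.counit c
  mul_right : ∀ b c₁ c₂, β b (c₁ * c₂) = tensorPairing β (Coalgebra.comul b) (c₁ ⊗ₜ c₂)
  one_right : ∀ b, β b 1 = Coalgebra.counit b
  antipode : ∀ b c, β (HopfAlgebra.antipode ℚ b) c = β b (HopfAlgebra.antipode ℚ c)

end DuallyPaired

/-! ### Bilinear pairings of Hopf algebras and the adjointness of antipodes -/

section DuallyPaired
variable {B C : Type*} [Ring B] [HopfAlgebra ℚ B] [Ring C] [HopfAlgebra ℚ C]

/-! The form pairs `h_P` with a colored symmetric function `f` by reading off the coefficient in `f`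
of a monomial whose words are those of `P`. Permuting second indices does not change the
coefficients of `f`, so any such monomial gives the same value (`SymA.pairing_hM_words`), and `⟨h_P,
m_Q⟩ = δ_{P,Q}` is immediate. Uniqueness holds because `(h_P)` and `(m_Q)` are bases.

With this description the bialgebra axioms become statements about monomials. The coproduct of
`Sym_A` splits the index set into two copies of itself: the coefficient of `Δ f` at a pair `(K, L)`
is the coefficient of `f` at `K.join L` (`SymA.coeff₂_comul`). The words of `K.join L` are those of
`K` together with those of `L`, so on the other side the join corresponds to the product `h_P h_Q`.

Dually, the coefficient of `f g` at `K` is a sum over the factorizations of `K`. What has to be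
shown is that `Δ(h_P)` is the sum of the corresponding tensors over the factorizations of a single
monomial with words `P` (`PSym.exists_comul_hM`). If `P` is one word `w`, all letters share one
index and the factorizations are the cuts `w = uv`, which is the definition of `Δ(h_w)`. If there
are several words, they sit at different indices and are cut independently, which is the
multiplicativity of `Δ`.

The adjointness of the antipodes is formal: composing the pairing with either antipode gives a
one-sided convolution inverse of it, on opposite sides, and such inverses coincide
(`isDuallyPaired_of_bialgebra`).

Evaluation on the graded dual satisfies the same axioms, and `h*_P ↦ m_P` carries it to the pairing
with `Sym_A` (`GradedDual.pairing_equivSymA`). An element of `Sym_A` is determined by its pairings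
with `PSym_A`, so products and antipodes, being adjoint to structure on `PSym_A`, are preserved. The
counit is evaluation at `1` in both cases, and the two coproducts have the same formula on the
bases. -/

theorem tensorPairing_tmul (β : B →ₗ[ℚ] C →ₗ[ℚ] ℚ) (b₁ b₂ : B) (c₁ c₂ : C) :
    tensorPairing β (b₁ ⊗ₜ b₂) (c₁ ⊗ₜ c₂) = β b₁ c₁ * β b₂ c₂ := by
  simp [tensorPairing]

/-- Against a pure tensor the induced pairing is an evaluation `tensorEval`, the form in which the
coproducts of `Sym_A` and of the graded dual have been computed. -/
theorem tensorPairing_tmul_left (β : B →ₗ[ℚ] C →ₗ[ℚ] ℚ) (b₁ b₂ : B) (t : C ⊗[ℚ] C) :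
    tensorPairing β (b₁ ⊗ₜ b₂) t = tensorEval (β b₁) (β b₂) t := by
  induction t with
  | zero => simp
  | add x y hx hy => rw [map_add, map_add, hx, hy]
  | tmul c₁ c₂ => rw [tensorPairing_tmul, tensorEval_tmul]

theorem tensorPairing_tmul_right (β : B →ₗ[ℚ] C →ₗ[ℚ] ℚ) (t : B ⊗[ℚ] B) (c₁ c₂ : C) :
    tensorPairing β t (c₁ ⊗ₜ c₂) = tensorEval (β.flip c₁) (β.flip c₂) t := by
  induction t with
  | zero => simp
  | add x y hx hy => rw [map_add, map_add, LinearMap.add_apply, hx, hy]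
  | tmul b₁ b₂ => rw [tensorPairing_tmul, tensorEval_tmul]; rfl

/-- The antipodes are adjoint as soon as the bialgebra structures are: both
`(b, c) ↦ ⟨S b, c⟩` and `(b, c) ↦ ⟨b, S c⟩` are convolution inverses of the pairing. -/
theorem isDuallyPaired_of_bialgebra (β : B →ₗ[ℚ] C →ₗ[ℚ] ℚ)
    (mul_left : ∀ b₁ b₂ c, β (b₁ * b₂) c = tensorPairing β (b₁ ⊗ₜ b₂) (Coalgebra.comul c))
    (one_left : ∀ c, β 1 c = Coalgebra.counit c)
    (mul_right : ∀ b c₁ c₂, β b (c₁ * c₂) = tensorPairing β (Coalgebra.comul b) (c₁ ⊗ₜ c₂))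
    (one_right : ∀ b, β b 1 = Coalgebra.counit b) : IsDuallyPaired β where
  mul_left := mul_left
  one_left := one_left
  mul_right := mul_right
  one_right := one_right
  antipode b c := by
    -- Bilinear forms on `B × C` are regarded as maps from `B` to the convolution algebra of linear
    -- forms on `C`; convolving once more over `B` gives the product dual to the coproduct of `B ⊗
    -- C`. `F`, `G` and `H` are the pairing, `⟨S b, c⟩` and `⟨b, S c⟩`.
    let e : (C →ₗ[ℚ] ℚ) →ₗ[ℚ] WithConv (C →ₗ[ℚ] ℚ) :=
      (WithConv.linearEquiv ℚ (C →ₗ[ℚ] ℚ)).symm.toLinearMap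
    let F : WithConv (B →ₗ[ℚ] WithConv (C →ₗ[ℚ] ℚ)) := .toConv (e ∘ₗ β)
    let G : WithConv (B →ₗ[ℚ] WithConv (C →ₗ[ℚ] ℚ)) :=
      .toConv (e ∘ₗ β ∘ₗ HopfAlgebra.antipode ℚ)
    let H : WithConv (B →ₗ[ℚ] WithConv (C →ₗ[ℚ] ℚ)) :=
      .toConv (e ∘ₗ β.compl₂ (HopfAlgebra.antipode ℚ))
    have hone : ∀ b c, ((1 : WithConv (B →ₗ[ℚ] WithConv (C →ₗ[ℚ] ℚ))) b) c =
        Coalgebra.counit (R := ℚ) b * Coalgebra.counit (R := ℚ) c := by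
      intro b c
      rw [LinearMap.convOne_apply, LinearMap.convAlgebraMap_apply]
      simp
    -- The axiom `mul_left` says that `b ↦ ⟨b, ·⟩` is multiplicative into the convolution algebra of
    -- linear forms on `C`.
    have hmul : ∀ b₁ b₂, e (β b₁) * e (β b₂) = e (β (b₁ * b₂)) := by
      intro b₁ b₂
      refine congrArg WithConv.toConv (LinearMap.ext fun c => ?_)
      rw [mul_left, tensorPairing_tmul_left]; rfl
    have hGF : G * F = 1 := by
      refine congrArg WithConv.toConv (LinearMap.ext fun b => ?_)
      refine congrArg WithConv.toConv (LinearMap.ext fun c => ?_)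
      refine Eq.trans ?_ (hone b c).symm
      let r := Coalgebra.Repr.arbitrary ℚ b
      -- In Sweedler notation `(G * F)(b) = ⟨S(b₁) b₂, ·⟩`, and the antipode axiom of `B` collapses
      -- this to `ε(b) ⟨1, ·⟩`.
      have h1 : (G * F) b = e (β (∑ i ∈ r.index, HopfAlgebra.antipode ℚ (r.left i) * r.right i)) := by
        rw [r.convMul_apply, map_sum, map_sum]
        exact Finset.sum_congr rfl fun i _ => hmul _ _
      rw [HopfAlgebra.sum_antipode_mul_eq_algebraMap_counit, Algebra.algebraMap_eq_smul_one,
        map_smul] at h1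
      refine (congrArg (fun f : WithConv (C →ₗ[ℚ] ℚ) => f c) h1).trans ?_
      change Coalgebra.counit (R := ℚ) b * β 1 c = _
      rw [one_left]
    have hFH : F * H = 1 := by
      refine congrArg WithConv.toConv (LinearMap.ext fun b => ?_)
      refine congrArg WithConv.toConv (LinearMap.ext fun c => ?_)
      refine Eq.trans ?_ (hone b c).symm
      let r := Coalgebra.Repr.arbitrary ℚ b
      let q := Coalgebra.Repr.arbitrary ℚ c
      -- Here the antipode axiom of `C` is used: `∑ ⟨b₁, c₁⟩ ⟨b₂, S(c₂)⟩ = ⟨b, c₁ S(c₂)⟩ = ε(c) ⟨b,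
      -- 1⟩`, the first equality being `mul_right`.
      have h1 : ((F * H) b) c = β b (∑ j ∈ q.index, q.left j * HopfAlgebra.antipode ℚ (q.right j)) := by
        have h2 : ((F * H) b) c = ∑ i ∈ r.index, (F (r.left i) * H (r.right i)) c := by
          rw [r.convMul_apply]
          -- Evaluation at `c` has to be exhibited as a linear map before it can pass through the
          -- sum.
          change WithConv.linearEquiv ℚ (C →ₗ[ℚ] ℚ) _ c = _
          rw [map_sum, LinearMap.sum_apply]; rfl
        rw [h2, map_sum]
        simp only [mul_right]
        conv_rhs => rw [← r.eq]
        simp only [map_sum, LinearMap.sum_apply, tensorPairing_tmul]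
        rw [Finset.sum_comm]
        refine Finset.sum_congr rfl fun i _ => ?_
        rw [q.convMul_apply]; rfl
      rw [HopfAlgebra.sum_mul_antipode_eq_algebraMap_counit, Algebra.algebraMap_eq_smul_one,
        map_smul, one_right, smul_eq_mul, mul_comm] at h1
      exact h1
    have hGH : G = H := left_inv_eq_right_inv hGF hFH
    exact congrArg (fun f : WithConv (B →ₗ[ℚ] WithConv (C →ₗ[ℚ] ℚ)) => (f b) c) hGH

end DuallyPaired

/-! ### Factorizations of joined monomials and of one-index monomials -/

namespace Monom
variable {A : Type*}

/-- `join` is multiplicative with inverse `K ↦ (K.left, K.right)`, so the two halves of a joined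
monomial factor independently. -/
theorem sum_factorizations_join {M : Type*} [AddCommMonoid M] (K L : Monom A)
    (F : Monom A → Monom A → M) : ∑ p ∈ (K.join L).factorizations, F p.1 p.2 =
      ∑ p ∈ K.factorizations, ∑ q ∈ L.factorizations, F (p.1.join q.1) (p.2.join q.2) := by
  rw [← Finset.sum_product']
  refine Finset.sum_bij' (fun p _ => ((p.1.left, p.2.left), (p.1.right, p.2.right)))
    (fun r _ => (r.1.1.join r.2.1, r.1.2.join r.2.2)) ?_ ?_ ?_ ?_ ?_
  · rintro ⟨I, J⟩ h
    simp only [Finset.mem_product, mem_factorizations] at h ⊢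
    rw [← left_mul, ← right_mul, h, left_join, right_join]
    exact ⟨rfl, rfl⟩
  · rintro ⟨⟨I, J⟩, ⟨I', J'⟩⟩ h
    simp only [Finset.mem_product, mem_factorizations] at h ⊢
    rw [join_mul, h.1, h.2]
  · rintro ⟨I, J⟩ _; simp only [join_left_right]
  · rintro ⟨⟨I, J⟩, ⟨I', J'⟩⟩ _; simp only [left_join, right_join]
  · rintro ⟨I, J⟩ _; simp only [join_left_right]

open Classical in
/-- The monomial whose variables all have second index `1` and spell `l`. -/
noncomputable def single (l : List A) : Monom A :=
  ⟨fun i => if i = 1 then FreeMonoid.ofList l else 1,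
    (Set.finite_singleton 1).subset fun i hi => by
      by_contra h
      exact hi (if_neg h)⟩

theorem single_val_one (l : List A) : (single l).1 1 = FreeMonoid.ofList l := by
  simp [single]

theorem single_val_ne (l : List A) {i : ℕ+} (hi : i ≠ 1) : (single l).1 i = 1 := by
  simp [single, hi]

theorem ext_single {K : Monom A} {l : List A} (h1 : K.1 1 = FreeMonoid.ofList l)
    (h : ∀ i, i ≠ 1 → K.1 i = 1) : K = single l := by
  refine Monom.ext (funext fun i => ?_)
  by_cases hi : i = 1
  · rw [hi, h1, single_val_one]
  · rw [h i hi, single_val_ne l hi]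

theorem single_mul (l l' : List A) : single l * single l' = single (l ++ l') :=
  ext_single (by rw [mul_val, single_val_one, single_val_one]; rfl) fun i hi => by
    rw [mul_val, single_val_ne l hi, single_val_ne l' hi, one_mul]

theorem single_nil : single ([] : List A) = 1 :=
  (ext_single (K := 1) rfl fun _ _ => rfl).symm

theorem words_single (w : Word A) : (single w.1).words = {w} := by
  have hs : (single w.1).supp = {1} := by
    ext i
    rw [mem_supp, Finset.mem_singleton]
    by_cases h : i = 1
    · rw [h, single_val_one]
      exact iff_of_true w.2 rfl
    · simp [single_val_ne w.1 h, h]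
  have h1 : Word.toWord (FreeMonoid.toList ((single w.1).1 1)) = some w :=
    toWord_eq_some.2 (by rw [single_val_one]; rfl)
  rw [words_eq, hs, Finset.singleton_val, ← Multiset.cons_zero,
    Multiset.filterMap_cons_some (fun i => Word.toWord (FreeMonoid.toList ((single w.1).1 i))) _ _ h1]
  rfl

/-- The empty word contributes no word to the monomial, in agreement with `h_∅ = 1`. The two extreme
cuts of a word therefore need no separate treatment. -/
theorem hM_words_single (l : List A) : PSym.hM (single l).words = PSym.gen l := by
  by_cases h : l = []
  · rw [h, single_nil, words_one, PSym.hM_zero, PSym.gen_nil]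
  · rw [show single l = single (⟨l, h⟩ : Word A).1 from rfl, words_single, PSym.hM_singleton]

/-- At an index other than `1` the two words concatenate to the empty word, hence both are empty. -/
theorem eq_single_of_mul_eq_single {I J : Monom A} {l : List A} (h : I * J = single l) :
    I = single (FreeMonoid.toList (I.1 1)) ∧ J = single (FreeMonoid.toList (J.1 1)) := by
  have h0 : ∀ i, i ≠ 1 → I.1 i = 1 ∧ J.1 i = 1 := fun i hi => by
    have : FreeMonoid.toList (I.1 i) ++ FreeMonoid.toList (J.1 i) = [] :=
      (congrArg (fun K : Monom A => K.1 i) h).trans (single_val_ne l hi)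
    exact List.append_eq_nil_iff.1 this
  exact ⟨ext_single rfl fun i hi => (h0 i hi).1, ext_single rfl fun i hi => (h0 i hi).2⟩

/-- A factorization is a cut of `l`, recorded by the length of the first factor. There are `l.length
+ 1` cuts, counting those where one factor is `1`. -/
theorem sum_factorizations_single {M : Type*} [AddCommMonoid M] (l : List A)
    (F : Monom A → Monom A → M) : ∑ p ∈ (single l).factorizations, F p.1 p.2 =
      ∑ i ∈ Finset.range (l.length + 1), F (single (l.take i)) (single (l.drop i)) := by
  have append_eq : ∀ p ∈ (single l).factorizations,
      FreeMonoid.toList (p.1.1 1) ++ FreeMonoid.toList (p.2.1 1) = l := fun p hp =>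
    (congrArg (fun K : Monom A => K.1 1) (mem_factorizations.1 hp)).trans (single_val_one l)
  have heq : ∀ p ∈ (single l).factorizations,
      single (l.take (FreeMonoid.toList (p.1.1 1)).length) = p.1 ∧
      single (l.drop (FreeMonoid.toList (p.1.1 1)).length) = p.2 := by
    intro p hp
    have h := eq_single_of_mul_eq_single (mem_factorizations.1 hp)
    rw [← append_eq p hp, List.take_left, List.drop_left]
    exact ⟨h.1.symm, h.2.symm⟩
  refine Finset.sum_bij' (fun p _ => (FreeMonoid.toList (p.1.1 1)).length)
    (fun i _ => (single (l.take i), single (l.drop i))) ?_ ?_ ?_ ?_ ?_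
  · intro p hp
    have := congrArg List.length (append_eq p hp)
    rw [List.length_append] at this
    rw [Finset.mem_range]; omega
  · intro i _
    rw [mem_factorizations, single_mul, List.take_append_drop]
  · intro p hp
    exact Prod.ext (heq p hp).1 (heq p hp).2
  · intro i hi
    -- The bound `i ≤ l.length` ensures that `l.take i` has length exactly `i`.
    rw [Finset.mem_range] at hi
    change (FreeMonoid.toList ((single (l.take i)).1 1)).length = i
    rw [single_val_one, FreeMonoid.toList_ofList, List.length_take]; omega
  · intro p hp
    rw [(heq p hp).1, (heq p hp).2]

end Monom

/-! ### The coproduct of `PSym_A` in terms of factorizations -/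

namespace PSym
variable {A : Type*}

/-- The coproduct of `h_s` runs over the factorizations of a monomial with words `s`. -/
theorem exists_comul_hM (s : Multiset (Word A)) : ∃ K : Monom A, K.words = s ∧
    Coalgebra.comul (R := ℚ) (hM s) =
      ∑ p ∈ K.factorizations, hM p.1.words ⊗ₜ[ℚ] hM p.2.words := by
  induction s using Multiset.induction with
  | empty =>
    -- The trivial monomial is written as `single []` so that the formula for the cuts of a word
    -- applies to it.
    refine ⟨Monom.single [], by rw [Monom.single_nil, Monom.words_one], ?_⟩
    rw [Monom.sum_factorizations_single [] fun I J => hM I.words ⊗ₜ[ℚ] hM J.words]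
    simp [Monom.hM_words_single, gen_nil, hM_zero, Algebra.TensorProduct.one_def]
  | cons w t ih =>
    obtain ⟨L, rfl, hL⟩ := ih
    -- The new word is placed in the half of the index set that `L` does not occupy, so that its
    -- cuts are independent of the factorizations of `L`.
    refine ⟨(Monom.single w.1).join L, by
      rw [Monom.words_join, Monom.words_single, Multiset.singleton_add], ?_⟩
    rw [Monom.sum_factorizations_join _ _ fun I J => hM I.words ⊗ₜ[ℚ] hM J.words, hM_cons,
      Bialgebra.comul_mul, hL, comul_gen,
      Monom.sum_factorizations_single w.1 fun I J => ∑ q ∈ L.factorizations,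
        hM (I.join q.1).words ⊗ₜ[ℚ] hM (J.join q.2).words, Finset.sum_mul_sum]
    simp only [Monom.words_join, hM_add, Monom.hM_words_single, Algebra.TensorProduct.tmul_mul_tmul]

end PSym

/-! ### The pairing of `PSym_A` with `Sym_A` -/

namespace SymA
open ColoredPowerSeries
variable {A : Type*} [LinearOrder A] [Finite A]

/-- The pairing with `⟨h_P, f⟩` the coefficient in `f` of any monomial with p-sentence `P`. -/
noncomputable def pairing (A : Type*) [LinearOrder A] : PSym A →ₗ[ℚ] SymA A →ₗ[ℚ] ℚ :=
  PSym.basisH.constr ℚ fun P => coeffL (rep P)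

theorem pairing_h (P : PSent A) : pairing A (PSym.h P) = coeffL (rep P) := by
  rw [pairing, ← PSym.basisH_apply, Module.Basis.constr_basis]

/-- Invariance under permutations of the indices frees the pairing from the chosen representatives
`rep P`; joins and factors of representatives are in general not representatives themselves. -/
theorem pairing_hM_words (K : Monom A) : pairing A (PSym.hM K.words) = coeffL K := by
  rw [← PSym.h_sort, pairing_h]
  exact LinearMap.ext fun f => coeff_rep f K

theorem pairing_h_m (P Q : PSent A) : pairing A (PSym.h P) (m Q) = if P = Q then 1 else 0 := by
  rw [pairing_h]
  refine (coeff_m (rep P) Q).trans ?_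
  rw [words_rep, PSent.sort_toMultiset]

/-- The coordinates of `f` in the basis `(m_P)` are exactly its pairings with the `h_P`. -/
theorem eq_of_pairing {f g : SymA A} (h : ∀ x, pairing A x f = pairing A x g) : f = g :=
  repr.injective (Finsupp.ext fun P => by
    have := h (PSym.h P)
    rwa [pairing_h] at this)

theorem pairing_unique {β : PSym A →ₗ[ℚ] SymA A →ₗ[ℚ] ℚ}
    (h : ∀ P Q : PSent A, β (PSym.h P) (m Q) = if P = Q then 1 else 0) : β = pairing A :=
  PSym.basisH.ext fun P => basisM.ext fun Q => by
    rw [PSym.basisH_apply, basisM_apply, h, pairing_h_m]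

theorem isDuallyPaired_pairing : IsDuallyPaired (pairing A) := by
  refine isDuallyPaired_of_bialgebra _ (fun x y f => ?_) (fun f => ?_) (fun x f g => ?_) fun x => ?_
  -- Both sides are packaged as bilinear maps in `(x, y)`, so that it suffices to compare them on
  -- the basis `(h_P)`.
  · have key : (LinearMap.mul ℚ (PSym A)).compr₂ ((pairing A).flip f) =
        (TensorProduct.mk ℚ (PSym A) (PSym A)).compr₂
          ((tensorPairing (pairing A)).flip (Coalgebra.comul f)) := by
      refine LinearMap.ext_basis PSym.basisH PSym.basisH fun P Q => ?_
      rw [PSym.basisH_apply, PSym.basisH_apply]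
      change pairing A (PSym.h P * PSym.h Q) f =
        tensorPairing (pairing A) (PSym.h P ⊗ₜ PSym.h Q) (Coalgebra.comul f)
      -- The product `h_P h_Q` is attached to the words of `(rep P).join (rep Q)`, so pairing with
      -- it reads off a coefficient at a join, which is a coefficient of `Δ f`.
      rw [tensorPairing_tmul_left, pairing_h, pairing_h, PSym.h_eq, PSym.h_eq, ← PSym.hM_add,
        ← words_rep P, ← words_rep Q, ← Monom.words_join, pairing_hM_words]
      exact (coeff₂_comul _ _ f).symm
    exact LinearMap.congr_fun₂ key x y
  -- Both sides are the constant coefficient of `f`.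
  · rw [counit_eq, ← PSym.hM_zero, ← Monom.words_one, pairing_hM_words]; rfl
  · have key : (pairing A).flip (f * g) =
        (tensorPairing (pairing A)).flip (f ⊗ₜ g) ∘ₗ Coalgebra.comul := by
      refine PSym.basisH.ext fun P => ?_
      rw [PSym.basisH_apply, PSym.h_eq]
      -- `K` need not be `rep P`: any monomial with the words of `P` computes the pairing. The claim
      -- then becomes the definition of the coefficient of `f g` at `K`.
      obtain ⟨K, hK, hΔ⟩ := PSym.exists_comul_hM P.toMultiset
      rw [LinearMap.comp_apply, hΔ, ← hK, LinearMap.flip_apply, pairing_hM_words, map_sum]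
      simp only [LinearMap.flip_apply, tensorPairing_tmul, pairing_hM_words]
      exact coeff_mul K f.1 g.1
    exact LinearMap.congr_fun key x
  · have key : (pairing A).flip 1 = Coalgebra.counit := by
      refine PSym.basisH.ext fun P => ?_
      rw [PSym.basisH_apply, LinearMap.flip_apply, ← m_empty, pairing_h_m, PSym.h_eq,
        PSym.counit_hM]
      refine if_congr ⟨fun h => ?_, fun h => ?_⟩ rfl rfl
      · rw [h, PSent.empty, PSent.toMultiset_sort]
      · rw [PSent.empty, ← h, PSent.sort_toMultiset]
    exact LinearMap.congr_fun key x

end SymA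

/-! ### The graded dual and its isomorphism with `Sym_A` -/

namespace GradedDual
variable {A : Type*} [LinearOrder A] [Finite A]

/-- The convolution product is by definition the transpose of `Δ`; that the coproduct given on the
`h*_P` is the transpose of the multiplication is `eval_comul`. -/
theorem isDuallyPaired_eval : IsDuallyPaired (eval A) := by
  refine isDuallyPaired_of_bialgebra _ (fun x y φ => ?_) (fun φ => (counit_eq φ).symm)
    (fun x φ ψ => ?_) eval_one
  · rw [tensorPairing_tmul_left, eval_comul]
  · rw [tensorPairing_tmul_right]; rfl

/-- The linear isomorphism `h*_P ↦ m_P`. -/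
noncomputable def equivSymA (A : Type*) [LinearOrder A] [Finite A] : GradedDual A ≃ₗ[ℚ] SymA A :=
  basisStar.equiv SymA.basisM (Equiv.refl _)

theorem equivSymA_hStar (P : PSent A) : equivSymA A (hStar P) = SymA.m P := by
  rw [← basisStar_apply, equivSymA, Module.Basis.equiv_apply, SymA.basisM_apply]; rfl

/-- Both sides are `δ_{P,Q}` on `(h_P, h*_Q)`. Through this identity every structure map that is
adjoint to one of `PSym_A` is transported from one dual to the other. -/
theorem pairing_equivSymA (x : PSym A) (φ : GradedDual A) :
    SymA.pairing A x (equivSymA A φ) = eval A x φ := by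
  have key : (SymA.pairing A).compl₂ (equivSymA A).toLinearMap = eval A := by
    refine LinearMap.ext_basis PSym.basisH basisStar fun P Q => ?_
    rw [LinearMap.compl₂_apply, LinearEquiv.coe_coe, basisStar_apply, equivSymA_hStar,
      PSym.basisH_apply, SymA.pairing_h_m, eval_hStar]
    exact if_congr eq_comm rfl rfl
  exact LinearMap.congr_fun₂ key x φ

/-- Both products are adjoint to the same coproduct of `PSym_A`, and the pairing separates the
elements of `Sym_A`. -/
theorem equivSymA_mul (φ ψ : GradedDual A) :
    equivSymA A (φ * ψ) = equivSymA A φ * equivSymA A ψ := by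
  refine SymA.eq_of_pairing fun x => ?_
  have hflip : ∀ φ, (SymA.pairing A).flip (equivSymA A φ) = (eval A).flip φ := fun φ =>
    LinearMap.ext fun x => pairing_equivSymA x φ
  rw [pairing_equivSymA, isDuallyPaired_eval.mul_right, SymA.isDuallyPaired_pairing.mul_right,
    tensorPairing_tmul_right, tensorPairing_tmul_right, hflip, hflip]

theorem counit_equivSymA :
    Coalgebra.counit ∘ₗ (equivSymA A).toLinearMap = Coalgebra.counit (R := ℚ) :=
  LinearMap.ext fun φ => by
    rw [LinearMap.comp_apply, ← SymA.isDuallyPaired_pairing.one_left,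
      ← isDuallyPaired_eval.one_left]
    exact pairing_equivSymA 1 φ

theorem comul_equivSymA :
    TensorProduct.map (equivSymA A).toLinearMap (equivSymA A).toLinearMap ∘ₗ Coalgebra.comul =
      Coalgebra.comul (R := ℚ) ∘ₗ (equivSymA A).toLinearMap := by
  refine basisStar.ext fun P => ?_
  have hΔ : Coalgebra.comul (R := ℚ) (hStar P) = ∑ Q ∈ P.sub, hStar Q ⊗ₜ[ℚ] hStar (P.diff Q) :=
    unshuffle_basis basisStar P
  simp only [LinearMap.comp_apply, basisStar_apply, hΔ, map_sum, TensorProduct.map_tmul,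
    LinearEquiv.coe_coe, equivSymA_hStar, SymA.comul_m]

/-- Both antipodes are adjoint to the antipode of `PSym_A`. -/
theorem equivSymA_antipode (φ : GradedDual A) :
    equivSymA A (HopfAlgebra.antipode ℚ φ) = HopfAlgebra.antipode ℚ (equivSymA A φ) :=
  SymA.eq_of_pairing fun x => by
    rw [pairing_equivSymA, ← isDuallyPaired_eval.antipode, ← SymA.isDuallyPaired_pairing.antipode,
      pairing_equivSymA]

end GradedDual

/-! ### The main theorem -/

theorem mainTheorem3 (A : Type*) [LinearOrder A] [Finite A] :
    (∃ β : PSym A →ₗ[ℚ] SymA A →ₗ[ℚ] ℚ,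
      (∀ P S : PSent A, β (PSym.h P) (SymA.m S) = if P = S then 1 else 0) ∧
      (∀ β' : PSym A →ₗ[ℚ] SymA A →ₗ[ℚ] ℚ,
        (∀ P S : PSent A, β' (PSym.h P) (SymA.m S) = if P = S then 1 else 0) → β' = β) ∧
      IsDuallyPaired β) ∧
    IsDuallyPaired (GradedDual.eval A) ∧
    ∃ Φ : GradedDual A ≃ₐc[ℚ] SymA A,
      (∀ P : PSent A, Φ (GradedDual.hStar P) = SymA.m P) ∧
      ∀ φ : GradedDual A, Φ (HopfAlgebra.antipode ℚ φ) = HopfAlgebra.antipode ℚ (Φ φ) := by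
  refine ⟨⟨SymA.pairing A, SymA.pairing_h_m, fun _ h => SymA.pairing_unique h,
    SymA.isDuallyPaired_pairing⟩, GradedDual.isDuallyPaired_eval,
    -- Preservation of the unit need not be supplied: a multiplicative bijection has it
    -- automatically.
    { GradedDual.equivSymA A with
      counit_comp := GradedDual.counit_equivSymA
      map_comp_comul := GradedDual.comul_equivSymA
      map_mul' := GradedDual.equivSymA_mul },
    GradedDual.equivSymA_hStar, GradedDual.equivSymA_antipode⟩
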